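/- Let $K_0(\mathrm{Var}/\mathbb C)$ be the Grothendieck ring of complex algebraic varieties: the quotient of the group of formal integer combinations of isomorphism classes $[Z]$ of complex algebraic varieties (reduced separated schemes of finite type over $\mathbb C$) by the relations $[Z]=[U]+[Z\setminus U]$ for all open subvarieties $U\subseteq Z$, with the product induced by $[X][Y]=[X\times Y]$. Let $L=[\mathbb A^1_{\mathbb C}]$ be the class of the affine line. Let $V=\mathbb C^7$. For a $7$-dimensional space $W\subset\Lambda^2V^\vee$ of skew forms on $V$, let $X_W$ be the closed subvariety of the Grassmannian $G(2,V)$ (in its Plücker embedding) consisting of all two-dimensional subspaces $T\subset V$ such that $w|_T=0$ for all $w\in W$, and let $Y_W$ be the closed subvariety of $\mathbb PW\subset\mathbb P\Lambda^2V^\vee$ consisting of all $\mathbb Cw$ such that the skew form $w$ has rank less than $6$. Both carry the reduced structure. **Proposition 2.8.** For generic $W$, that is, for all $W$ in some non-empty Zariski open subset of the Grassmannian $G(7,\Lambda^2V^\vee)$, the equality $$\big([X_W]-[Y_W]\big)(L^2-1)(L-1)L^7=0$$ holds in $K_0(\mathrm{Var}/\mathbb C)$. -/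

import Mathlib

/-! # The Grothendieck ring of complex varieties and the two varieties attached to a space of forms -/

namespace PfaffianGrassmannian

noncomputable section

open CategoryTheory AlgebraicGeometry MonoidalCategory
open scoped TensorProduct

/-! ## Complex varieties -/

/-- A complex algebraic variety: a reduced separated scheme of finite type over `Spec ℂ`
(not necessarily irreducible, possibly empty). -/
def IsComplexVariety : ObjectProperty (Over (Spec (.of ℂ) : Scheme.{0})) := fun X =>
  AlgebraicGeometry.IsReduced X.left ∧ IsSeparated X.hom ∧
    LocallyOfFiniteType X.hom ∧ QuasiCompact X.hom

/-- The category of complex algebraic varieties and morphisms over `Spec ℂ`. -/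
abbrev ComplexVariety : Type 1 := IsComplexVariety.FullSubcategory

/-! A product of complex varieties is again a complex variety; the point to check is that it is
reduced. -/

theorem isReduced_tensorProduct_complex (A B : Type) [CommRing A] [CommRing B] [Algebra ℂ A]
    [Algebra ℂ B] [Algebra.FiniteType ℂ A] [IsReduced A] [IsReduced B] : IsReduced (A ⊗[ℂ] B) := by
  let b := Module.Free.chooseBasis ℂ B
  let c : Module.Basis _ A (A ⊗[ℂ] B) := b.baseChange A
  have : IsJacobsonRing A := isJacobsonRing_of_finiteType (A := ℂ)
  have key : ∀ (m : Ideal A) [m.IsMaximal] (z : A ⊗[ℂ] B), IsNilpotent z → ∀ i, c.repr z i ∈ m := by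
    intro m hm z hz i
    have : Algebra.FiniteType ℂ (A ⧸ m) := inferInstance
    let := Ideal.Quotient.field m
    have : Module.Finite ℂ (A ⧸ m) := finite_of_finite_type_of_isJacobsonRing ℂ (A ⧸ m)
    have hbij : Function.Bijective (algebraMap ℂ (A ⧸ m)) :=
      IsAlgClosed.algebraMap_bijective_of_isIntegral
    let e : ℂ ≃ₐ[ℂ] (A ⧸ m) := AlgEquiv.ofBijective (Algebra.ofId _ _) hbij
    let φ : A →ₐ[ℂ] ℂ := (e.symm : (A ⧸ m) →ₐ[ℂ] ℂ).comp (Ideal.Quotient.mkₐ ℂ m)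
    let ψ : A ⊗[ℂ] B →ₐ[ℂ] B :=
      Algebra.TensorProduct.lift ((Algebra.ofId ℂ B).comp φ) (AlgHom.id ℂ B) (fun _ _ => .all _ _)
    have h0 : ψ z = 0 := (hz.map ψ).eq_zero
    have h1 : ∀ y : A ⊗[ℂ] B, b.repr (ψ y) i = φ (c.repr y i) := by
      intro y
      induction y with
      | zero => simp
      | add x y hx hy => simp [hx, hy]
      | tmul a x =>
        have hx : ψ (a ⊗ₜ[ℂ] x) = φ a • x := by simp [ψ, Algebra.ofId_apply, Algebra.smul_def]
        rw [hx]
        simp [c, mul_comm]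
    have h2 : φ (c.repr z i) = 0 := by rw [← h1, h0]; simp
    have h3 : Ideal.Quotient.mk m (c.repr z i) = 0 := by simpa [φ] using h2
    exact Ideal.Quotient.eq_zero_iff_mem.mp h3
  refine ⟨fun z hz => ?_⟩
  apply c.repr.injective
  ext i
  rw [map_zero, Finsupp.zero_apply]
  have : c.repr z i ∈ Ideal.jacobson (⊥ : Ideal A) := by
    rw [Ideal.jacobson, Ideal.mem_sInf]
    rintro m ⟨-, hm⟩
    exact key m z hz i
  rwa [IsJacobsonRing.out ‹_› ((Ideal.isRadical_iff_quotient_reduced _).mpr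
    (isReduced_of_injective (RingEquiv.quotientBot A) (RingEquiv.quotientBot A).injective))] at this

theorem isReduced_pullback_spec_complex (A B : CommRingCat.{0})
    (f : Spec A ⟶ Spec (.of ℂ)) (g : Spec B ⟶ Spec (.of ℂ))
    [hA : IsReduced (Spec A)] [hB : IsReduced (Spec B)] [hf : LocallyOfFiniteType f] :
    IsReduced (Limits.pullback f g) := by
  obtain ⟨φ, rfl⟩ := Spec.map_surjective f
  obtain ⟨γ, rfl⟩ := Spec.map_surjective g
  rw [HasRingHomProperty.Spec_iff (P := @LocallyOfFiniteType)] at hf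
  rw [affine_isReduced_iff] at hA hB
  algebraize [φ.hom, γ.hom]
  have := isReduced_tensorProduct_complex A B
  have : IsReduced (Spec (.of (A ⊗[ℂ] B))) := (affine_isReduced_iff _).mpr this
  exact isReduced_of_isOpenImmersion (pullbackSpecIso ℂ A B).hom

theorem isReduced_pullback_complex {X Y : Scheme.{0}} (f : X ⟶ Spec (.of ℂ)) (g : Y ⟶ Spec (.of ℂ))
    [IsReduced X] [IsReduced Y] [LocallyOfFiniteType f] : AlgebraicGeometry.IsReduced (Limits.pullback f g) := by
  have (i : (Scheme.Pullback.openCoverOfLeftRight X.affineCover Y.affineCover f g).I₀) :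
      IsReduced ((Scheme.Pullback.openCoverOfLeftRight X.affineCover Y.affineCover f g).X i) := by
    obtain ⟨i, j⟩ := i
    have h1 : LocallyOfFiniteType (X.affineCover.f i ≫ f) := inferInstance
    have h2 : IsReduced (X.affineCover.X i) := isReduced_of_isOpenImmersion (X.affineCover.f i)
    have h3 : IsReduced (Y.affineCover.X j) := isReduced_of_isOpenImmersion (Y.affineCover.f j)
    change IsReduced (Limits.pullback (X.affineCover.f i ≫ f) (Y.affineCover.f j ≫ g))
    generalize X.affineCover.f i ≫ f = f' at h1 ⊢
    generalize Y.affineCover.f j ≫ g = g'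
    exact isReduced_pullback_spec_complex _ _ f' g' (hA := h2) (hB := h3) (hf := h1)
  exact @IsReduced.of_openCover _
    (Scheme.Pullback.openCoverOfLeftRight X.affineCover Y.affineCover f g) this

/-- Complex varieties are closed under products over `Spec ℂ`, and contain the point `Spec ℂ`.
Hence `ComplexVariety` is a monoidal category under the product over `Spec ℂ`, and its
isomorphism classes `Skeleton ComplexVariety` form a commutative monoid. -/
instance isMonoidal_isComplexVariety : IsComplexVariety.IsMonoidal where
  prop_unit := by
    refine ⟨?_, ?_, ?_, ?_⟩
    · exact (affine_isReduced_iff (.of ℂ)).mpr (inferInstanceAs (_root_.IsReduced ℂ))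
    all_goals dsimp; infer_instance
  prop_tensor X Y hX hY := by
    obtain ⟨_, _, _, _⟩ := hX
    obtain ⟨_, _, _, _⟩ := hY
    refine ⟨isReduced_pullback_complex _ _, ?_, ?_, ?_⟩ <;> dsimp <;> infer_instance

/-! ## The Grothendieck ring -/

/-- The cut-and-paste relations `[Z] - [U] - [Z \ U]`, for `U` an open subvariety of a variety
`Z`; the complement of `U` is the closed subvariety `C` (with its reduced structure, as varieties
are reduced). They live in the ring of formal integer combinations of isomorphism classes of
varieties, with the product `[X] * [Y] = [X × Y]`. -/
def scissorRelations : Set (MonoidAlgebra ℤ (Skeleton ComplexVariety)) :=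
  {r | ∃ (Z U C : ComplexVariety) (j : U ⟶ Z) (i : C ⟶ Z),
    IsOpenImmersion j.hom.left ∧ IsClosedImmersion i.hom.left ∧
    Set.range i.hom.left = (Set.range j.hom.left)ᶜ ∧
    r = MonoidAlgebra.of ℤ _ (toSkeleton Z) - MonoidAlgebra.of ℤ _ (toSkeleton U)
      - MonoidAlgebra.of ℤ _ (toSkeleton C)}

/-- The Grothendieck ring of complex varieties `K₀(Var/ℂ)`. The product of a cut-and-paste relation
with a class `[T]` is a cut-and-paste relation (for `U × T` in `Z × T`), so the ideal spanned by
these relations is the subgroup that they generate. -/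
abbrev K0Var : Type 1 := MonoidAlgebra ℤ (Skeleton ComplexVariety) ⧸ Ideal.span scissorRelations

/-- The class `[X]` of a variety in the Grothendieck ring. -/
def K0Var.cls (X : ComplexVariety) : K0Var :=
  Ideal.Quotient.mk _ (MonoidAlgebra.of ℤ _ (toSkeleton X))

/-- The affine line over `ℂ`. -/
def affineLine : ComplexVariety where
  obj := Over.mk (Spec.map (CommRingCat.ofHom (algebraMap ℂ (Polynomial ℂ))))
  property := by
    refine ⟨(affine_isReduced_iff (.of (Polynomial ℂ))).mpr
      (inferInstanceAs (_root_.IsReduced (Polynomial ℂ))), ?_, ?_, ?_⟩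
    · dsimp; infer_instance
    · dsimp
      rw [HasRingHomProperty.Spec_iff (P := @LocallyOfFiniteType)]
      exact RingHom.finiteType_algebraMap.mpr inferInstance
    · dsimp; infer_instance

/-- The class `L` of the affine line. -/
def K0Var.L : K0Var := K0Var.cls affineLine

/-! ## Closed subvarieties of projective space -/

attribute [local instance] MvPolynomial.gradedAlgebra

/-- The structure morphism to `Spec ℂ` of the projective space `Proj ℂ[x_s : s ∈ σ]` of lines
in `ℂ^σ`. -/
def projectiveSpaceHom (σ : Type) :
    Proj (MvPolynomial.homogeneousSubmodule σ ℂ) ⟶ Spec (.of ℂ) :=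
  Proj.toSpecZero _ ≫
    Spec.map (CommRingCat.ofHom (algebraMap ℂ (MvPolynomial.homogeneousSubmodule σ ℂ 0)))

instance (σ : Type) [Finite σ] : IsSeparated (projectiveSpaceHom σ) := by
  unfold projectiveSpaceHom; infer_instance

theorem algebraMap_homogeneousSubmodule_zero_surjective (σ : Type) :
    Function.Surjective (algebraMap ℂ (MvPolynomial.homogeneousSubmodule σ ℂ 0)) := by
  rintro ⟨f, hf⟩
  have := (MvPolynomial.totalDegree_zero_iff_isHomogeneous σ).mpr hf
  exact ⟨f.coeff 0, Subtype.ext (MvPolynomial.totalDegree_eq_zero_iff_eq_C.mp this).symm⟩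

instance (σ : Type) [Finite σ] :
    Algebra.FiniteType (MvPolynomial.homogeneousSubmodule σ ℂ 0) (MvPolynomial σ ℂ) :=
  have : IsScalarTower ℂ (MvPolynomial.homogeneousSubmodule σ ℂ 0) (MvPolynomial σ ℂ) :=
    ⟨fun a b c => smul_mul_assoc a b.1 c⟩
  .of_restrictScalars_finiteType ℂ _ _

instance (σ : Type) [Finite σ] : LocallyOfFiniteType (projectiveSpaceHom σ) := by
  have := IsClosedImmersion.spec_of_surjective
    (CommRingCat.ofHom (algebraMap ℂ (MvPolynomial.homogeneousSubmodule σ ℂ 0)))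
    (algebraMap_homogeneousSubmodule_zero_surjective σ)
  unfold projectiveSpaceHom; infer_instance

instance (σ : Type) [Finite σ] : QuasiCompact (projectiveSpaceHom σ) := by
  unfold projectiveSpaceHom; infer_instance

theorem isReduced_subscheme_vanishingIdeal {X : Scheme.{0}} (Z : TopologicalSpace.Closeds X) :
    AlgebraicGeometry.IsReduced (Scheme.IdealSheafData.vanishingIdeal Z).subscheme := by
  have (U : (Scheme.IdealSheafData.vanishingIdeal Z).subschemeCover.I₀) : AlgebraicGeometry.IsReduced
      ((Scheme.IdealSheafData.vanishingIdeal Z).subschemeCover.openCover.X U) := by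
    apply (affine_isReduced_iff _).mpr
    apply (Ideal.isRadical_iff_quotient_reduced _).mp
    exact PrimeSpectrum.isRadical_vanishingIdeal _
  exact @IsReduced.of_openCover _ (Scheme.IdealSheafData.vanishingIdeal Z).subschemeCover.openCover this

/-- The closed subset of the projective space of lines in `ℂ^σ` defined by all the homogeneous
polynomials that vanish on `S`: the Zariski closure of the set of points `ℂ x`, `x ∈ S`,
which is the set of these points itself if that set is Zariski closed. -/
def projectiveClosedSet {σ : Type} (S : Set (σ → ℂ)) :
    TopologicalSpace.Closeds (Proj (MvPolynomial.homogeneousSubmodule σ ℂ)) where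
  carrier := ProjectiveSpectrum.zeroLocus (MvPolynomial.homogeneousSubmodule σ ℂ)
    {f | (∃ n, f.IsHomogeneous n) ∧ ∀ x ∈ S, MvPolynomial.eval x f = 0}
  isClosed' := ProjectiveSpectrum.isClosed_zeroLocus _ _

/-- The closed subvariety (with its reduced structure) of the projective space of lines in `ℂ^σ`
whose points are the `ℂ x`, `x ∈ S`; used for sets `S` of non-zero vectors, stable under non-zero
scalars, for which this set of points is Zariski closed. -/
def projectiveSubvariety {σ : Type} [Finite σ] (S : Set (σ → ℂ)) : ComplexVariety where
  obj := Over.mk ((Scheme.IdealSheafData.vanishingIdeal (projectiveClosedSet S)).subschemeι ≫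
    projectiveSpaceHom σ)
  property := by
    refine ⟨isReduced_subscheme_vanishingIdeal _, ?_, ?_, ?_⟩ <;> dsimp <;> infer_instance

/-! ## The varieties attached to a space of skew forms

`V = ℂ^7`, and a bilinear form on `V` is given by its Gram matrix `w`, with
`w(u, v) = u ⬝ᵥ w *ᵥ v`. -/

open Matrix

/-- The space `Λ²V^∨` of skew forms on `V = ℂ^7`. -/
def skewForms : Submodule ℂ (Matrix (Fin 7) (Fin 7) ℂ) where
  carrier := {w | wᵀ = -w}
  add_mem' := by
    intro a b ha hb
    change (a + b)ᵀ = -(a + b)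
    rw [transpose_add, show aᵀ = -a from ha, show bᵀ = -b from hb, neg_add]
  zero_mem' := by simp
  smul_mem' := by
    intro c a ha
    change (c • a)ᵀ = -(c • a)
    rw [transpose_smul, show aᵀ = -a from ha, smul_neg]

/-- The Plücker vector `u ∧ v ∈ Λ²V`, written as the skew tensor `u ⊗ v - v ⊗ u`:
its coordinates are the `2 × 2` minors `u i * v j - u j * v i`. -/
def wedge (u v : Fin 7 → ℂ) : Fin 7 × Fin 7 → ℂ := fun p => u p.1 * v p.2 - u p.2 * v p.1

/-- The variety `X_W` of two-dimensional subspaces `T` of `V` on which all forms `w ∈ W` vanish,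
as a closed subvariety of the Grassmannian `G(2, V)` in its Plücker embedding: a subspace
`T` with basis `u, v` is the point `ℂ (u ∧ v)`, and `w` vanishes on `T` iff `w(u, v) = 0`. -/
def varietyX (W : Submodule ℂ (Matrix (Fin 7) (Fin 7) ℂ)) : ComplexVariety :=
  projectiveSubvariety
    {p | ∃ u v : Fin 7 → ℂ, LinearIndependent ℂ ![u, v] ∧ (∀ w ∈ W, u ⬝ᵥ w *ᵥ v = 0) ∧
      p = wedge u v}

/-- The variety `Y_W` of forms of rank less than `6` in the projective space of `W`, as a closed
subvariety of the projective space of all matrices. -/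
def varietyY (W : Submodule ℂ (Matrix (Fin 7) (Fin 7) ℂ)) : ComplexVariety :=
  projectiveSubvariety
    {p : Fin 7 × Fin 7 → ℂ | ∃ w ∈ W, w ≠ 0 ∧ w.rank < 6 ∧ p = fun ij => w ij.1 ij.2}

/-- `P W` holds for a generic seven-dimensional space `W` of skew forms on `V`, that is, for all
`W` in some non-empty Zariski open subset of the Grassmannian `G(7, Λ²V^∨)`. In terms of bases of
`W`: there is a polynomial `F` in the coefficients of seven matrices, not identically zero on
7-tuples of skew forms, such that `P` holds for the span of every linearly independent 7-tuple
of skew forms at which `F` does not vanish. -/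
def HoldsForGenericW (P : Submodule ℂ (Matrix (Fin 7) (Fin 7) ℂ) → Prop) : Prop :=
  ∃ F : MvPolynomial (Fin 7 × Fin 7 × Fin 7) ℂ,
    (∃ w : Fin 7 → Matrix (Fin 7) (Fin 7) ℂ, (∀ k, w k ∈ skewForms) ∧
      MvPolynomial.eval (fun a => w a.1 a.2.1 a.2.2) F ≠ 0) ∧
    ∀ w : Fin 7 → Matrix (Fin 7) (Fin 7) ℂ, (∀ k, w k ∈ skewForms) → LinearIndependent ℂ w →
      MvPolynomial.eval (fun a => w a.1 a.2.1 a.2.2) F ≠ 0 →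
      P (Submodule.span ℂ (Set.range w))

end

end PfaffianGrassmannian

/-!
The proof computes the class of one incidence variety in two ways. Fix a basis `w 0, …, w 6` of
`W`. For each `k`, the forms `w k + ∑ l > k, b l • w l` make up an affine cell of `ℙW`, and the
incidence variety over this cell consists of all `(u, v, b)` such that the form with parameters
`b` vanishes on the pair `(u, v)` of vectors of `V`.

* Over the pairs `(u, v)`, the condition is one affine equation in `b`. Its coefficients are the
  values `w l (u, v)`, so for given `k` the solution set depends, up to isomorphism, only on the
  first `j` such that all `w l` with `j ≤ l` vanish on `(u, v)`. Summed over `k`, the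
  contributions telescope to a multiple of the class of the set of all isotropic pairs, on which
  all of `W` vanishes (`mu_incidence_eq_pairs`). The linearly independent isotropic pairs are the
  bases of the planes in `X_W`, so their class is `[X_W] [GL₂] = [X_W] (L² - 1) (L² - L)`
  (`mu_isotropicPairs_eq_sum`).
* Over the forms, the condition is linear in `v` for given `b` and `u`, and it is void iff `u` is
  in the kernel of the form. This kernel has dimension one, or three over `Y_W`, as soon as no
  nonzero form in `W` has rank two (`mu_incidence_eq_kernels`, `mu_kernels`). Hence the total is
  affine linear in `[Y_W]`, with leading coefficient `(L³ - L) (L⁷ - L⁶)`.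

Comparing the two gives `([X_W] - [Y_W]) (L² - 1) (L - 1) L⁷ = 0`; all the other terms are
polynomials in `L`, and cancel (`cls_sub_mul_eq_zero`). The generality of `W` is only used to
exclude forms of rank two: seven forms with a decomposable combination depend on `146` parameters,
fewer than the `147` coordinates of seven forms, so their coordinates satisfy a polynomial
relation (`exists_polynomial_of_decomposable`).

All the varieties involved, except `X_W` and `Y_W` themselves, are Zariski closed subsets `Z` of
vector spaces, and are handled through their points: `mu Z` is the class of `Z`, polynomial
bijections with polynomial inverse preserve it (`mu_congr`), and an open subset `h ≠ 0` is again
closed in a vector space, after adding the inverse of `h` as a coordinate (`mu_eq_add`). The one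
fibration result needed is that a family of solvable linear systems of constant rank has the class
of a product (`mu_linSys`); it holds because Cramer's rule trivializes it where a given minor does
not vanish. A projective variety decomposes into affine cells according to the first nonvanishing
one among linear forms (`cls_projectiveSubvariety_eq_sum`); this is the only place where the
scheme structure of a closed subset of projective space is used.
-/

/-! ### The class of an affine variety -/

namespace PfaffianGrassmannian

noncomputable section

open CategoryTheory AlgebraicGeometry MonoidalCategory
open scoped TensorProduct

/-- A reduced closed subscheme is determined by its underlying set. -/
theorem exists_iso_of_range_eq {P Q T : Scheme.{0}} (f : P ⟶ T) (g : Q ⟶ T) [IsClosedImmersion f]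
    [IsClosedImmersion g] [AlgebraicGeometry.IsReduced P] [AlgebraicGeometry.IsReduced Q]
    (h : Set.range f = Set.range g) : ∃ e : P ≅ Q, e.hom ≫ g = f := by
  have hs : Surjective (Limits.pullback.snd f g) := by
    refine ⟨fun q => ?_⟩
    obtain ⟨p, hp⟩ : g q ∈ Set.range f := h ▸ ⟨q, rfl⟩
    obtain ⟨z, -, hz⟩ := Scheme.Pullback.exists_preimage_pullback p q hp
    exact ⟨z, hz⟩
  have hf : Surjective (Limits.pullback.fst f g) := by
    refine ⟨fun p => ?_⟩
    obtain ⟨q, hq⟩ : f p ∈ Set.range g := h ▸ ⟨p, rfl⟩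
    obtain ⟨z, hz, -⟩ := Scheme.Pullback.exists_preimage_pullback p q hq.symm
    exact ⟨z, hz⟩
  have := isIso_of_isClosedImmersion_of_surjective (Limits.pullback.snd f g)
  have := isIso_of_isClosedImmersion_of_surjective (Limits.pullback.fst f g)
  refine ⟨(asIso (Limits.pullback.fst f g)).symm ≪≫ asIso (Limits.pullback.snd f g), ?_⟩
  simp [← Limits.pullback.condition]

namespace K0Var

theorem cls_eq_of_iso {X Y : ComplexVariety} (e : X.obj.left ≅ Y.obj.left)
    (he : e.hom ≫ Y.obj.hom = X.obj.hom) : cls X = cls Y := by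
  unfold cls
  congr 2
  exact Quotient.sound ⟨ObjectProperty.isoMk _ (Over.isoMk e he)⟩

theorem cls_eq_add {Z U C : ComplexVariety} (j : U.obj.left ⟶ Z.obj.left)
    (i : C.obj.left ⟶ Z.obj.left) (hj : j ≫ Z.obj.hom = U.obj.hom) (hi : i ≫ Z.obj.hom = C.obj.hom)
    (hj' : IsOpenImmersion j) (hi' : IsClosedImmersion i) (h : Set.range i = (Set.range j)ᶜ) :
    cls Z = cls U + cls C := by
  have : Ideal.Quotient.mk (Ideal.span scissorRelations)
      (MonoidAlgebra.of ℤ _ (toSkeleton Z) - MonoidAlgebra.of ℤ _ (toSkeleton U)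
      - MonoidAlgebra.of ℤ _ (toSkeleton C)) = 0 := by
    apply Ideal.Quotient.eq_zero_iff_mem.mpr
    apply Ideal.subset_span
    exact ⟨Z, U, C, ⟨Over.homMk j hj⟩, ⟨Over.homMk i hi⟩, ‹_›, ‹_›, h, rfl⟩
  rw [map_sub, map_sub] at this
  unfold cls
  linear_combination this

theorem cls_tensor (X Y : ComplexVariety) : cls (X ⊗ Y) = cls X * cls Y := by
  unfold cls
  rw [Skeleton.toSkeleton_tensorObj, map_mul, map_mul]

theorem cls_unit : cls (𝟙_ ComplexVariety) = 1 := by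
  unfold cls
  rw [← Skeleton.one_eq, map_one, map_one]

/-- A product of classes, computed by any model of the fibre product of schemes. -/
theorem cls_mul_eq {X Y Z : ComplexVariety} (e : Limits.pullback X.obj.hom Y.obj.hom ≅ Z.obj.left)
    (he : e.hom ≫ Z.obj.hom = Limits.pullback.fst X.obj.hom Y.obj.hom ≫ X.obj.hom) :
    cls X * cls Y = cls Z := by
  rw [← cls_tensor]
  exact cls_eq_of_iso (X := X ⊗ Y) e he

end K0Var

/-- An isomorphism of `ℂ`-algebras, as an isomorphism of spectra. -/
def specIso {A B : Type} [CommRing A] [Algebra ℂ A] [CommRing B] [Algebra ℂ B] (e : A ≃ₐ[ℂ] B) :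
    Spec (.of B) ≅ Spec (.of A) where
  hom := Spec.map (CommRingCat.ofHom (e : A →+* B))
  inv := Spec.map (CommRingCat.ofHom (e.symm : B →+* A))
  hom_inv_id := by
    rw [← Spec.map_comp, ← CommRingCat.ofHom_comp, ← Spec.map_id]
    congr 2
    ext x
    exact e.apply_symm_apply x
  inv_hom_id := by
    rw [← Spec.map_comp, ← CommRingCat.ofHom_comp, ← Spec.map_id]
    congr 2
    ext x
    exact e.symm_apply_apply x

theorem specIso_hom_comp {A B : Type} [CommRing A] [Algebra ℂ A] [CommRing B] [Algebra ℂ B]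
    (e : A ≃ₐ[ℂ] B) : (specIso e).hom ≫ Spec.map (CommRingCat.ofHom (algebraMap ℂ A)) =
      Spec.map (CommRingCat.ofHom (algebraMap ℂ B)) := by
  dsimp [specIso]
  rw [← Spec.map_comp, ← CommRingCat.ofHom_comp]
  congr 2
  ext x
  exact e.commutes x

/-- The affine variety `Spec A`, for a reduced finitely generated `ℂ`-algebra `A`. -/
def affineVariety (A : Type) [CommRing A] [Algebra ℂ A] [Algebra.FiniteType ℂ A]
    [_root_.IsReduced A] : ComplexVariety where
  obj := Over.mk (Spec.map (CommRingCat.ofHom (algebraMap ℂ A)))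
  property := by
    refine ⟨(affine_isReduced_iff (.of A)).mpr ‹_›, ?_, ?_, ?_⟩
    · dsimp; infer_instance
    · dsimp
      rw [HasRingHomProperty.Spec_iff (P := @LocallyOfFiniteType)]
      exact RingHom.finiteType_algebraMap.mpr inferInstance
    · dsimp; infer_instance

/-- The class of the affine variety `Spec A`. -/
def specCls (A : Type) [CommRing A] [Algebra ℂ A] [Algebra.FiniteType ℂ A]
    [_root_.IsReduced A] : K0Var := K0Var.cls (affineVariety A)

section

variable (A B C : Type) [CommRing A] [Algebra ℂ A] [Algebra.FiniteType ℂ A]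
    [_root_.IsReduced A] [CommRing B] [Algebra ℂ B] [Algebra.FiniteType ℂ B]
    [_root_.IsReduced B] [CommRing C] [Algebra ℂ C] [Algebra.FiniteType ℂ C]
    [_root_.IsReduced C]

variable {A B C} in
theorem specCls_congr (e : A ≃ₐ[ℂ] B) : specCls A = specCls B :=
  (K0Var.cls_eq_of_iso (X := affineVariety B) (Y := affineVariety A) (specIso e)
    (specIso_hom_comp e)).symm

variable {A B C} in
/-- The cut-and-paste relation for the principal open subset `a ≠ 0` of `Spec A`. -/
theorem specCls_eq_add (a : A) (φ : A →ₐ[ℂ] B) (ψ : A →ₐ[ℂ] C)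
    (hφ : let _ := φ.toRingHom.toAlgebra; IsLocalization.Away a B)
    (hψ : Function.Surjective ψ) (hker : RingHom.ker ψ = (Ideal.span {a}).radical) :
    specCls A = specCls B + specCls C := by
  let _ := φ.toRingHom.toAlgebra
  have h1 : IsOpenImmersion (Spec.map (CommRingCat.ofHom (algebraMap A B))) :=
    IsOpenImmersion.of_isLocalization a
  have h2 : IsClosedImmersion (Spec.map (CommRingCat.ofHom (ψ : A →+* C))) :=
    IsClosedImmersion.spec_of_surjective _ hψ
  refine K0Var.cls_eq_add (Z := affineVariety A) (U := affineVariety B) (C := affineVariety C)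
    (Spec.map (CommRingCat.ofHom (algebraMap A B)))
    (Spec.map (CommRingCat.ofHom (ψ : A →+* C))) ?_ ?_ h1 h2 ?_
  · dsimp [affineVariety]
    rw [← Spec.map_comp, ← CommRingCat.ofHom_comp]
    congr 2
    ext x
    exact φ.commutes x
  · dsimp [affineVariety]
    rw [← Spec.map_comp, ← CommRingCat.ofHom_comp]
    congr 2
    ext x
    exact ψ.commutes x
  · have e1 := PrimeSpectrum.localization_away_comap_range B a
    have e2 := range_comap_of_surjective _ (ψ : A →+* C) hψ
    refine e2.trans ?_
    refine Eq.trans ?_ (congrArg _ e1).symm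
    change PrimeSpectrum.zeroLocus (RingHom.ker ψ : Set A) = _
    rw [hker, PrimeSpectrum.zeroLocus_radical, PrimeSpectrum.zeroLocus_span,
      PrimeSpectrum.basicOpen_eq_zeroLocus_compl]
    exact (compl_compl _).symm

instance : _root_.IsReduced (Polynomial A) := by
  have := isReduced_tensorProduct_complex A (Polynomial ℂ)
  exact isReduced_of_injective (polyEquivTensor ℂ A).toRingHom (polyEquivTensor ℂ A).injective

/-- The product of `Spec A` with the affine line is the spectrum of `A[T]`. -/
theorem specCls_polynomial : specCls (Polynomial A) = specCls A * K0Var.L := by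
  have hL : K0Var.L = K0Var.cls (affineVariety (Polynomial ℂ)) := rfl
  rw [hL]
  symm
  refine K0Var.cls_mul_eq (X := affineVariety A) (Y := affineVariety (Polynomial ℂ))
    (Z := affineVariety (Polynomial A))
    (pullbackSpecIso ℂ A (Polynomial ℂ) ≪≫ specIso (polyEquivTensor ℂ A)) ?_
  refine (Category.assoc _ _ _).trans ?_
  refine (congrArg _ (specIso_hom_comp (polyEquivTensor ℂ A))).trans ?_
  exact pullbackSpecIso_hom_base ..

/-- The empty variety is its own open subvariety with empty complement. -/
theorem specCls_of_subsingleton [Subsingleton A] : specCls A = 0 := by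
  have h := specCls_eq_add (0 : A) (AlgHom.id ℂ A) (AlgHom.id ℂ A)
    (IsLocalization.away_of_isUnit_of_bijective _ (isUnit_of_subsingleton _)
      Function.bijective_id) Function.surjective_id (Subsingleton.elim _ _)
  linear_combination -h

theorem specCls_complex : specCls ℂ = 1 := by
  have h : (Iso.refl (Spec (.of ℂ))).hom ≫ 𝟙 (Spec (.of ℂ)) =
      Spec.map (CommRingCat.ofHom (algebraMap ℂ ℂ)) := by
    rw [Category.comp_id]
    exact (Spec.map_id _).symm
  rw [← K0Var.cls_unit]
  exact K0Var.cls_eq_of_iso (X := affineVariety ℂ) (Y := 𝟙_ ComplexVariety)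
    (Iso.refl (Spec (.of ℂ))) h

end

end

end PfaffianGrassmannian

/-! ### Polynomial maps and Zariski closed sets -/

namespace PfaffianGrassmannian

noncomputable section

section PolynomialMaps

variable {E F G : Type} [AddCommGroup E] [Module ℂ E] [AddCommGroup F] [Module ℂ F]
  [AddCommGroup G] [Module ℂ G]

variable (E) in
/-- The algebra of polynomial functions on a complex vector space: it is generated by the linear
forms. -/
def polyFun : Subalgebra ℂ (E → ℂ) :=
  Algebra.adjoin ℂ (Set.range fun l : E →ₗ[ℂ] ℂ => (l : E → ℂ))

/-- A map between complex vector spaces is polynomial if its composition with each linear form is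
a polynomial function. -/
@[fun_prop]
def IsPoly (f : E → F) : Prop := ∀ l : F →ₗ[ℂ] ℂ, (fun x => l (f x)) ∈ polyFun E

theorem linear_mem_polyFun (l : E →ₗ[ℂ] ℂ) : (fun x => l x) ∈ polyFun E :=
  Algebra.subset_adjoin ⟨l, rfl⟩

theorem const_mem_polyFun (c : ℂ) : (fun _ => c) ∈ polyFun E := (polyFun E).algebraMap_mem c

@[elab_as_elim]
theorem polyFun_induction {p : (f : E → ℂ) → f ∈ polyFun E → Prop}
    (linear : ∀ l : E →ₗ[ℂ] ℂ, p (fun x => l x) (linear_mem_polyFun l))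
    (const : ∀ c, p (fun _ => c) (const_mem_polyFun c))
    (add : ∀ f g hf hg, p f hf → p g hg → p (fun x => f x + g x) (add_mem hf hg))
    (mul : ∀ f g hf hg, p f hf → p g hg → p (fun x => f x * g x) (mul_mem hf hg))
    {f : E → ℂ} (hf : f ∈ polyFun E) : p f hf := by
  induction hf using Algebra.adjoin_induction with
  | mem x hx => obtain ⟨l, rfl⟩ := hx; exact linear l
  | algebraMap r => exact const r
  | add x y hx hy h1 h2 => exact add x y hx hy h1 h2
  | mul x y hx hy h1 h2 => exact mul x y hx hy h1 h2

theorem isPoly_iff_mem {f : E → ℂ} : IsPoly f ↔ f ∈ polyFun E := by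
  refine ⟨fun h => h LinearMap.id, fun h l => ?_⟩
  have : (fun x => l (f x)) = (fun _ => l 1) * f := by
    ext x
    simpa [mul_comm] using l.map_smul (f x) 1
  rw [this]
  exact mul_mem (const_mem_polyFun _) h

@[fun_prop]
theorem IsPoly.linear (l : E →ₗ[ℂ] F) : IsPoly fun x => l x :=
  fun m => linear_mem_polyFun (m ∘ₗ l)

@[fun_prop]
theorem IsPoly.id : IsPoly fun x : E => x := IsPoly.linear LinearMap.id

@[fun_prop]
theorem IsPoly.const (c : F) : IsPoly fun _ : E => c := fun l => const_mem_polyFun (l c)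

@[fun_prop]
theorem IsPoly.comp {g : F → G} {f : E → F} (hg : IsPoly g) (hf : IsPoly f) :
    IsPoly fun x => g (f x) := by
  have key : ∀ h ∈ polyFun F, (fun x => h (f x)) ∈ polyFun E := by
    intro h hh
    induction hh using polyFun_induction with
    | linear l => exact hf l
    | const c => exact const_mem_polyFun c
    | add p q _ _ hp hq => exact add_mem hp hq
    | mul p q _ _ hp hq => exact mul_mem hp hq
  exact fun l => key _ (hg l)

@[fun_prop]
theorem IsPoly.prodMk {f : E → F} {g : E → G} (hf : IsPoly f) (hg : IsPoly g) :
    IsPoly fun x => (f x, g x) := by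
  intro l
  have : (fun x => l (f x, g x)) = (fun x => (l ∘ₗ LinearMap.inl ℂ F G) (f x)) +
      fun x => (l ∘ₗ LinearMap.inr ℂ F G) (g x) := by
    ext x
    simp [← map_add]
  rw [this]
  exact add_mem (hf _) (hg _)

@[fun_prop]
theorem IsPoly.fst {f : E → F × G} (hf : IsPoly f) : IsPoly fun x => (f x).1 :=
  (IsPoly.linear (LinearMap.fst ℂ F G)).comp hf

@[fun_prop]
theorem IsPoly.snd {f : E → F × G} (hf : IsPoly f) : IsPoly fun x => (f x).2 :=
  (IsPoly.linear (LinearMap.snd ℂ F G)).comp hf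

@[fun_prop]
theorem IsPoly.pi {ι : Type} [Finite ι] {f : E → ι → F} (hf : ∀ i, IsPoly fun x => f x i) :
    IsPoly fun x i => f x i := by
  classical
  cases nonempty_fintype ι
  intro l
  have : (fun x => l fun i => f x i) =
      ∑ i, fun x => (l ∘ₗ LinearMap.single ℂ (fun _ => F) i) (f x i) := by
    ext x
    simp only [Finset.sum_apply, LinearMap.comp_apply, LinearMap.single_apply, ← map_sum,
      Finset.univ_sum_single]
  rw [this]
  exact sum_mem fun i _ => hf i _

@[fun_prop]
theorem IsPoly.apply {ι : Type} (i : ι) : IsPoly fun f : ι → F => f i :=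
  IsPoly.linear (LinearMap.proj (R := ℂ) (φ := fun _ => F) i)

@[fun_prop]
theorem IsPoly.add {f g : E → F} (hf : IsPoly f) (hg : IsPoly g) : IsPoly fun x => f x + g x := by
  intro l
  simp only [map_add]
  exact add_mem (hf l) (hg l)

@[fun_prop]
theorem IsPoly.neg {f : E → F} (hf : IsPoly f) : IsPoly fun x => -f x := by
  intro l
  simp only [map_neg]
  exact neg_mem (hf l)

@[fun_prop]
theorem IsPoly.sub {f g : E → F} (hf : IsPoly f) (hg : IsPoly g) : IsPoly fun x => f x - g x := by
  intro l
  simp only [map_sub]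
  exact sub_mem (hf l) (hg l)

@[fun_prop]
theorem IsPoly.smul {f : E → ℂ} {g : E → F} (hf : IsPoly f) (hg : IsPoly g) :
    IsPoly fun x => f x • g x := by
  intro l
  simp only [map_smul]
  exact mul_mem (isPoly_iff_mem.1 hf) (hg l)

@[fun_prop]
theorem IsPoly.mul {f g : E → ℂ} (hf : IsPoly f) (hg : IsPoly g) : IsPoly fun x => f x * g x :=
  hf.smul hg

@[fun_prop]
theorem IsPoly.sum {ι : Type} {s : Finset ι} {f : ι → E → F} (hf : ∀ i, IsPoly (f i)) :
    IsPoly fun x => ∑ i ∈ s, f i x := by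
  intro l
  simp only [map_sum]
  have : (fun x => ∑ i ∈ s, l (f i x)) = ∑ i ∈ s, fun x => l (f i x) := by ext; simp
  rw [this]
  exact sum_mem fun i _ => hf i l

@[fun_prop]
theorem IsPoly.prod {ι : Type} {s : Finset ι} {f : ι → E → ℂ} (hf : ∀ i, IsPoly (f i)) :
    IsPoly fun x => ∏ i ∈ s, f i x := by
  rw [isPoly_iff_mem]
  have : (fun x => ∏ i ∈ s, f i x) = ∏ i ∈ s, f i := by ext; simp
  rw [this]
  exact prod_mem fun i _ => isPoly_iff_mem.1 (hf i)

theorem IsPoly.det {ι : Type} [Fintype ι] [DecidableEq ι] {A : E → Matrix ι ι ℂ}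
    (hA : ∀ i j, IsPoly fun x => A x i j) : IsPoly fun x => (A x).det := by
  simp only [Matrix.det_apply', ← zsmul_eq_mul]
  simp only [zsmul_eq_mul]
  fun_prop

theorem IsPoly.adjugate {ι : Type} [Fintype ι] [DecidableEq ι] {A : E → Matrix ι ι ℂ}
    (hA : ∀ i j, IsPoly fun x => A x i j) (i j : ι) : IsPoly fun x => (A x).adjugate i j := by
  simp only [Matrix.adjugate_apply]
  refine IsPoly.det fun k l => ?_
  simp only [Matrix.updateRow_apply]
  split_ifs
  · fun_prop
  · exact hA k l

theorem IsPoly.eval {σ : Type} [Finite σ] (p : MvPolynomial σ ℂ) :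
    IsPoly fun x : σ → ℂ => MvPolynomial.eval x p := by
  induction p using MvPolynomial.induction_on with
  | C a => simp only [MvPolynomial.eval_C]; fun_prop
  | add p q hp hq => simp only [map_add]; fun_prop
  | mul_X p i hp => simp only [map_mul, MvPolynomial.eval_X]; fun_prop

/-- The homogeneous linear polynomial of a linear form. -/
def linPoly {σ : Type} [Fintype σ] [DecidableEq σ] (φ : (σ → ℂ) →ₗ[ℂ] ℂ) : MvPolynomial σ ℂ :=
  ∑ i, MvPolynomial.C (φ (Pi.single i 1)) * MvPolynomial.X i

theorem isHomogeneous_linPoly {σ : Type} [Fintype σ] [DecidableEq σ] (φ : (σ → ℂ) →ₗ[ℂ] ℂ) :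
    (linPoly φ).IsHomogeneous 1 := by
  refine MvPolynomial.IsHomogeneous.sum _ _ _ fun i _ => ?_
  simpa using (MvPolynomial.isHomogeneous_C _ (φ (Pi.single i 1))).mul
    (MvPolynomial.isHomogeneous_X ℂ i)

theorem eval_linPoly {σ : Type} [Fintype σ] [DecidableEq σ] (φ : (σ → ℂ) →ₗ[ℂ] ℂ) (x : σ → ℂ) :
    MvPolynomial.eval x (linPoly φ) = φ x := by
  conv_rhs => rw [pi_eq_sum_univ' x, map_sum]
  simp only [linPoly, map_sum, map_mul, MvPolynomial.eval_C, MvPolynomial.eval_X, map_smul,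
    smul_eq_mul]
  exact Finset.sum_congr rfl fun i _ => by
    rw [mul_comm]

theorem IsPoly.exists_eval {σ : Type} [Finite σ] {f : (σ → ℂ) → ℂ} (hf : IsPoly f) :
    ∃ p : MvPolynomial σ ℂ, ∀ x, f x = MvPolynomial.eval x p := by
  classical
  cases nonempty_fintype σ
  rw [isPoly_iff_mem] at hf
  induction hf using polyFun_induction with
  | linear l => exact ⟨linPoly l, fun x => (eval_linPoly l x).symm⟩
  | const c => exact ⟨MvPolynomial.C c, fun x => by simp⟩
  | add f g _ _ hf hg =>
    obtain ⟨p, hp⟩ := hf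
    obtain ⟨q, hq⟩ := hg
    exact ⟨p + q, fun x => by simp [hp, hq]⟩
  | mul f g _ _ hf hg =>
    obtain ⟨p, hp⟩ := hf
    obtain ⟨q, hq⟩ := hg
    exact ⟨p * q, fun x => by simp [hp, hq]⟩

end PolynomialMaps

section ClosedSets

variable {E F : Type} [AddCommGroup E] [Module ℂ E] [AddCommGroup F] [Module ℂ F]

/-- A subset of a complex vector space is Zariski closed if it is the set of common zeros of a
set of polynomial functions. -/
def ZClosed (Z : Set E) : Prop :=
  ∃ s : Set (E → ℂ), (∀ f ∈ s, IsPoly f) ∧ Z = {x | ∀ f ∈ s, f x = 0}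

theorem ZClosed.univ : ZClosed (Set.univ : Set E) := ⟨∅, by simp, by simp⟩

theorem ZClosed.iInter {ι : Sort*} {Z : ι → Set E} (h : ∀ i, ZClosed (Z i)) :
    ZClosed {x | ∀ i, x ∈ Z i} := by
  choose s hs hZ using h
  refine ⟨⋃ i, s i, ?_, ?_⟩
  · simp only [Set.mem_iUnion]
    rintro f ⟨i, hi⟩
    exact hs i f hi
  · ext x
    simp only [hZ, Set.mem_ofPred_eq, Set.mem_iUnion]
    exact ⟨fun h f ⟨i, hi⟩ => h i f hi, fun h i f hi => h f ⟨i, hi⟩⟩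

theorem ZClosed.zeros {f : E → F} (hf : IsPoly f) : ZClosed {x | f x = 0} := by
  refine ⟨Set.range fun l : F →ₗ[ℂ] ℂ => fun x => l (f x), ?_, ?_⟩
  · rintro _ ⟨l, rfl⟩
    exact (IsPoly.linear l).comp hf
  · ext x
    simp only [Set.mem_ofPred_eq, Set.forall_mem_range]
    exact ⟨fun h l => by rw [h, map_zero],
      fun h => (Module.forall_dual_apply_eq_zero_iff ℂ _).1 h⟩

theorem ZClosed.eq {f g : E → F} (hf : IsPoly f) (hg : IsPoly g) : ZClosed {x | f x = g x} := by
  simpa only [sub_eq_zero] using ZClosed.zeros (hf.sub hg)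

theorem ZClosed.inter {Y Z : Set E} (hY : ZClosed Y) (hZ : ZClosed Z) : ZClosed (Y ∩ Z) := by
  have := ZClosed.iInter (Z := fun b : Bool => if b then Y else Z) (by simp [hY, hZ])
  convert this using 1
  ext x
  simp [and_comm]

theorem ZClosed.preimage {Z : Set F} (hZ : ZClosed Z) {f : E → F} (hf : IsPoly f) :
    ZClosed {x | f x ∈ Z} := by
  obtain ⟨s, hs, rfl⟩ := hZ
  refine ⟨(fun g x => g (f x)) '' s, ?_, ?_⟩
  · rintro _ ⟨g, hg, rfl⟩
    exact (hs g hg).comp hf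
  · ext x
    simp

end ClosedSets

/-- The Nullstellensatz, in terms of `ℂ`-valued points. -/
theorem mem_radical_span_of_algHom {A : Type} [CommRing A] [Algebra ℂ A] [Algebra.FiniteType ℂ A]
    (g h : A) (H : ∀ φ : A →ₐ[ℂ] ℂ, φ h = 0 → φ g = 0) : g ∈ (Ideal.span {h}).radical := by
  have : IsJacobsonRing A := isJacobsonRing_of_finiteType (A := ℂ)
  rw [← IsJacobsonRing.out ‹_› (Ideal.radical_isRadical (Ideal.span {h})), Ideal.jacobson,
    Ideal.mem_sInf]
  rintro m ⟨hm, hmax⟩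
  have hh : h ∈ m := hm (Ideal.le_radical (Ideal.mem_span_singleton_self h))
  have : Algebra.FiniteType ℂ (A ⧸ m) := inferInstance
  let := Ideal.Quotient.field m
  have : Module.Finite ℂ (A ⧸ m) := finite_of_finite_type_of_isJacobsonRing ℂ (A ⧸ m)
  have hbij : Function.Bijective (algebraMap ℂ (A ⧸ m)) :=
    IsAlgClosed.algebraMap_bijective_of_isIntegral
  let e : ℂ ≃ₐ[ℂ] (A ⧸ m) := AlgEquiv.ofBijective (Algebra.ofId _ _) hbij
  have hmem : ∀ f : A, ((e.symm : (A ⧸ m) →ₐ[ℂ] ℂ).comp (Ideal.Quotient.mkₐ ℂ m)) f = 0 ↔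
      f ∈ m := by
    intro f
    rw [← Ideal.Quotient.eq_zero_iff_mem]
    simp
  exact (hmem g).1 (H _ ((hmem h).2 hh))

section CoordinateRing

variable {E F : Type} [AddCommGroup E] [Module ℂ E] [AddCommGroup F] [Module ℂ F]

/-- The algebra of restrictions to `Z` of the polynomial functions on a complex vector space. It
is the coordinate ring of the Zariski closure of `Z`, with its reduced structure. -/
def coordRing (Z : Set E) : Subalgebra ℂ (Z → ℂ) :=
  (polyFun E).map (AlgHom.pi fun z : Z => Pi.evalAlgHom ℂ (fun _ => ℂ) (z : E))

theorem mem_coordRing {Z : Set E} {g : Z → ℂ} :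
    g ∈ coordRing Z ↔ ∃ f : E → ℂ, IsPoly f ∧ ∀ z : Z, g z = f z := by
  simp only [coordRing, Subalgebra.mem_map, ← isPoly_iff_mem]
  refine exists_congr fun f => and_congr_right fun _ => ?_
  rw [funext_iff]
  exact forall_congr' fun z => eq_comm

/-- The restriction of a polynomial function, as an element of the coordinate ring. -/
def restr (Z : Set E) (f : E → ℂ) (hf : IsPoly f) : coordRing Z :=
  ⟨fun z => f z, mem_coordRing.2 ⟨f, hf, fun _ => rfl⟩⟩

theorem exists_restr {Z : Set E} (g : coordRing Z) : ∃ f hf, g = restr Z f hf := by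
  obtain ⟨f, hf, h⟩ := mem_coordRing.1 g.2
  exact ⟨f, hf, Subtype.ext (funext h)⟩

instance [FiniteDimensional ℂ E] (Z : Set E) : Algebra.FiniteType ℂ (coordRing Z) := by
  rw [← Subalgebra.fg_iff_finiteType]
  refine Subalgebra.FG.map _ ?_
  classical
  let b := Module.finBasis ℂ E
  refine ⟨Finset.univ.image fun i => (b.coord i : E → ℂ), le_antisymm ?_ ?_⟩
  · refine Algebra.adjoin_mono ?_
    simp only [Finset.coe_image, Finset.coe_univ, Set.image_univ, Set.range_subset_iff]
    exact fun i => ⟨b.coord i, rfl⟩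
  · refine Algebra.adjoin_le ?_
    rintro _ ⟨l, rfl⟩
    have : (l : E → ℂ) = ∑ i, l (b i) • (b.coord i : E → ℂ) := by
      ext x
      conv_lhs => rw [← b.sum_repr x]
      simp only [map_sum, map_smul, Finset.sum_apply, Pi.smul_apply, smul_eq_mul,
        Module.Basis.coord_apply, mul_comm]
    beta_reduce
    rw [this]
    exact sum_mem fun i _ => Subalgebra.smul_mem _ (Algebra.subset_adjoin (by simp)) _

instance (Z : Set E) : IsReduced (coordRing Z) :=
  isReduced_of_injective (coordRing Z).val Subtype.val_injective

/-- The pull-back of functions along a polynomial map. -/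
def pullFun {Z : Set E} {W : Set F} (f : E → F) (hf : IsPoly f) (h : ∀ z ∈ Z, f z ∈ W) :
    coordRing W →ₐ[ℂ] coordRing Z :=
  AlgHom.codRestrict ((AlgHom.pi fun z : Z =>
    Pi.evalAlgHom ℂ (fun _ => ℂ) (⟨f z, h z z.2⟩ : W)).comp (coordRing W).val) _ (by
    rintro ⟨g, hg⟩
    obtain ⟨p, hp, hpg⟩ := mem_coordRing.1 hg
    exact mem_coordRing.2 ⟨fun x => p (f x), hp.comp hf, fun z => hpg _⟩)

variable [FiniteDimensional ℂ E]

/-- A closed set contains all the `ℂ`-valued points of its coordinate ring. -/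
theorem exists_eq_eval {Z : Set E} (hZ : ZClosed Z) (φ : coordRing Z →ₐ[ℂ] ℂ) :
    ∃ z : Z, ∀ g, φ g = g.1 z := by
  have hmem : ∀ l : Module.Dual ℂ E, IsPoly fun x => l x := fun l => IsPoly.linear l
  -- The point is the one whose evaluation on the linear forms is given by `φ`.
  let δ : Module.Dual ℂ (Module.Dual ℂ E) :=
    { toFun := fun l => φ (restr Z (fun x => l x) (hmem l))
      map_add' := fun l m => by rw [← map_add]; rfl
      map_smul' := fun c l => by rw [← map_smul]; rfl }
  obtain ⟨x, hx⟩ := (Module.evalEquiv ℂ E).surjective δ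
  have key : ∀ f (hf : IsPoly f), φ (restr Z f hf) = f x := by
    intro f hf'
    have hf := hf'
    rw [isPoly_iff_mem] at hf
    induction hf using polyFun_induction with
    | linear l => exact (LinearMap.congr_fun hx l).symm
    | const c => exact φ.commutes c
    | add f g h1 h2 e1 e2 =>
      rw [← isPoly_iff_mem] at h1 h2
      beta_reduce
      rw [← e1 h1, ← e2 h2, ← map_add]; rfl
    | mul f g h1 h2 e1 e2 =>
      rw [← isPoly_iff_mem] at h1 h2
      beta_reduce
      rw [← e1 h1, ← e2 h2, ← map_mul]; rfl
  have hxZ : x ∈ Z := by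
    obtain ⟨s, hs, rfl⟩ := hZ
    intro f hf
    refine (key f (hs f hf)).symm.trans ((congrArg φ ?_).trans (map_zero φ))
    exact Subtype.ext (funext fun z => z.2 f hf)
  refine ⟨⟨x, hxZ⟩, fun g => ?_⟩
  obtain ⟨f, hf, rfl⟩ := exists_restr g
  exact key f hf

/-- The Nullstellensatz for a function vanishing where another one does. -/
theorem mem_radical_span_of_vanishing {Z : Set E} (hZ : ZClosed Z) (g h : coordRing Z)
    (H : ∀ z, h.1 z = 0 → g.1 z = 0) : g ∈ (Ideal.span {h}).radical := by
  refine mem_radical_span_of_algHom g h fun φ hφ => ?_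
  obtain ⟨z, hz⟩ := exists_eq_eval hZ φ
  rw [hz] at hφ ⊢
  exact H z hφ

end CoordinateRing

end

end PfaffianGrassmannian

/-! ### The class of a Zariski closed set -/

namespace PfaffianGrassmannian

noncomputable section

section MotivicClass

/-- A polynomial function of `x` and `(h x)⁻¹` becomes polynomial in `x` after multiplication by a
power of `h x`. -/
theorem exists_clear_denominator {E : Type} [AddCommGroup E] [Module ℂ E] (h : E → ℂ)
    (hh : IsPoly h) {f : E × ℂ → ℂ} (hf : IsPoly f) :
    ∃ (n : ℕ) (f' : E → ℂ), IsPoly f' ∧ ∀ x t, h x * t = 1 → f (x, t) * h x ^ n = f' x := by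
  rw [isPoly_iff_mem] at hf
  induction hf using polyFun_induction with
  | linear l =>
    refine ⟨1, fun x => l (x, 0) * h x + l (0, 1), ?_, fun x t ht => ?_⟩
    · fun_prop
    · have : ((x, t) : E × ℂ) = (x, 0) + t • (0, 1) := by simp
      beta_reduce
      rw [this, map_add, map_smul, smul_eq_mul]
      linear_combination l (0, 1) * ht
  | const c => exact ⟨0, fun _ => c, by fun_prop, fun x t _ => by simp⟩
  | add f g _ _ hf hg =>
    obtain ⟨n, f', hf', hn⟩ := hf
    obtain ⟨m, g', hg', hm⟩ := hg
    have hpow : ∀ k, IsPoly fun x => h x ^ k := fun k => by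
      simp only [← Fin.prod_const]; fun_prop
    have h1 := hpow n
    have h2 := hpow m
    refine ⟨n + m, fun x => f' x * h x ^ m + g' x * h x ^ n, by fun_prop, fun x t ht => ?_⟩
    beta_reduce
    rw [← hn x t ht, ← hm x t ht]
    ring
  | mul f g _ _ hf hg =>
    obtain ⟨n, f', hf', hn⟩ := hf
    obtain ⟨m, g', hg', hm⟩ := hg
    refine ⟨n + m, fun x => f' x * g' x, by fun_prop, fun x t ht => ?_⟩
    beta_reduce
    rw [← hn x t ht, ← hm x t ht]
    ring

/-- The coordinate ring of `Z × ℂ` is the polynomial ring over the coordinate ring of `Z`. -/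
def polynomialToCoordRing {E : Type} [AddCommGroup E] [Module ℂ E] (Z : Set E) :
    Polynomial (coordRing Z) →ₐ[ℂ] coordRing (Z ×ˢ (Set.univ : Set ℂ)) :=
  Polynomial.eval₂AlgHom (pullFun Prod.fst (by fun_prop) fun p hp => hp.1)
    (restr _ Prod.snd (by fun_prop)) fun _ => Commute.all _ _

theorem polynomialToCoordRing_apply {E : Type} [AddCommGroup E] [Module ℂ E] (Z : Set E)
    (P : Polynomial (coordRing Z)) (z : Z) (t : ℂ) :
    (polynomialToCoordRing Z P).1 ⟨(z, t), z.2, trivial⟩ =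
      (P.map ((Pi.evalRingHom (fun _ => ℂ) z).comp (coordRing Z).val.toRingHom)).eval t := by
  induction P using Polynomial.induction_on' with
  | add p q hp hq =>
    rw [Polynomial.map_add, Polynomial.eval_add, ← hp, ← hq, map_add]
    rfl
  | monomial n a =>
    rw [Polynomial.map_monomial, Polynomial.eval_monomial,
      show polynomialToCoordRing Z (Polynomial.monomial n a) = _ from Polynomial.eval₂_monomial _ _]
    rfl

variable {E F : Type} [AddCommGroup E] [Module ℂ E] [AddCommGroup F] [Module ℂ F]
  [FiniteDimensional ℂ E] [FiniteDimensional ℂ F]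

/-- The class in `K₀(Var/ℂ)` of a Zariski closed subset of a finite-dimensional complex vector
space, as an affine variety. (For any subset this is the class of its Zariski closure.) -/
def mu (Z : Set E) : K0Var := specCls (coordRing Z)

/-- Closed sets in bijection under mutually inverse polynomial maps have the same class. -/
theorem mu_congr {Z : Set E} {W : Set F} (f : E → F) (g : F → E) (hf : IsPoly f) (hg : IsPoly g)
    (hZ : ∀ z ∈ Z, f z ∈ W ∧ g (f z) = z) (hW : ∀ w ∈ W, g w ∈ Z ∧ f (g w) = w) :
    mu Z = mu W := by
  symm
  refine specCls_congr (AlgEquiv.ofAlgHom (pullFun f hf fun z hz => (hZ z hz).1)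
    (pullFun g hg fun w hw => (hW w hw).1) ?_ ?_)
  · refine AlgHom.ext fun a => Subtype.ext (funext fun z => ?_)
    exact congrArg a.1 (Subtype.ext (hZ z z.2).2)
  · refine AlgHom.ext fun a => Subtype.ext (funext fun w => ?_)
    exact congrArg a.1 (Subtype.ext (hW w w.2).2)

/-- The principal open subset `h ≠ 0` of `Z`, as the closed set of all `(x, t)` with `h x * t = 1`
(Rabinowitsch). -/
def princOpen (Z : Set E) (h : E → ℂ) : Set (E × ℂ) := {p | p.1 ∈ Z ∧ h p.1 * p.2 = 1}

/-- The cut-and-paste relation for closed subsets of vector spaces. -/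
theorem mu_eq_add {Z : Set E} (hZ : ZClosed Z) {h : E → ℂ} (hh : IsPoly h) :
    mu Z = mu (princOpen Z h) + mu (Z ∩ {x | h x = 0}) := by
  refine specCls_eq_add (restr Z h hh)
    (pullFun (Z := princOpen Z h) (W := Z) Prod.fst (by fun_prop) fun p hp => hp.1)
    (pullFun (Z := Z ∩ {x | h x = 0}) (W := Z) (fun x => x) (by fun_prop) fun x hx => hx.1)
    ?_ ?_ ?_
  · let φ := pullFun (Z := princOpen Z h) (W := Z) Prod.fst (by fun_prop) fun p hp => hp.1
    let _ := φ.toRingHom.toAlgebra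
    have hφ : ∀ a p, (algebraMap (coordRing Z) (coordRing (princOpen Z h)) a).1 p =
      a.1 ⟨p.1.1, p.2.1⟩ := fun a p => rfl
    refine ⟨?_, ?_, ?_⟩
    · rintro ⟨_, n, rfl⟩
      simp only [map_pow]
      refine IsUnit.pow _ (IsUnit.of_mul_eq_one
        (restr (princOpen Z h) Prod.snd (by fun_prop)) ?_)
      exact Subtype.ext (funext fun p => p.2.2)
    · intro b
      obtain ⟨f, hf, rfl⟩ := exists_restr b
      obtain ⟨n, f', hf', hn⟩ := exists_clear_denominator h hh hf
      refine ⟨⟨restr Z f' hf', ⟨_, n, rfl⟩⟩, ?_⟩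
      rw [map_pow]
      exact Subtype.ext (funext fun p => hn p.1.1 p.1.2 p.2.2)
    · intro a b hab
      refine ⟨⟨_, 1, rfl⟩, Subtype.ext (funext fun z => ?_)⟩
      change (h z) ^ 1 * a.1 z = (h z) ^ 1 * b.1 z
      by_cases hz : h z = 0
      · simp [hz]
      · have := congrFun (congrArg Subtype.val hab) ⟨(z, (h z)⁻¹), z.2, mul_inv_cancel₀ hz⟩
        rw [hφ, hφ] at this
        rw [this]
  · intro g
    obtain ⟨f, hf, rfl⟩ := exists_restr g
    exact ⟨restr Z f hf, rfl⟩
  · refine le_antisymm (fun g hg => ?_) ?_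
    · refine mem_radical_span_of_vanishing hZ _ _ fun z hz => ?_
      exact congrFun (congrArg Subtype.val (RingHom.mem_ker.1 hg)) ⟨z, z.2, hz⟩
    · refine Ideal.IsRadical.radical_le_iff (RingHom.ker_isRadical_iff_reduced_of_surjective
        ?_ |>.2 inferInstance) |>.2 ?_
      · intro g
        obtain ⟨f, hf, rfl⟩ := exists_restr g
        exact ⟨restr Z f hf, rfl⟩
      · rw [Ideal.span_singleton_le_iff_mem, RingHom.mem_ker]
        exact Subtype.ext (funext fun z => z.2.2)

theorem mu_prod_line (Z : Set E) : mu (Z ×ˢ (Set.univ : Set ℂ)) = mu Z * K0Var.L := by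
  rw [mu, mu, ← specCls_polynomial]
  symm
  refine specCls_congr (AlgEquiv.ofBijective (polynomialToCoordRing Z) ⟨?_, ?_⟩)
  · rw [injective_iff_map_eq_zero]
    intro P hP
    refine Polynomial.ext fun n => Subtype.ext (funext fun z => ?_)
    have : P.map ((Pi.evalRingHom (fun _ => ℂ) z).comp (coordRing Z).val.toRingHom) = 0 := by
      refine Polynomial.funext fun t => ?_
      rw [← polynomialToCoordRing_apply, hP, Polynomial.eval_zero]
      rfl
    have h2 := congrArg (fun Q => Q.coeff n) this
    rw [Polynomial.coeff_map] at h2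
    exact h2
  -- The surjectivity can be checked on the linear forms of `E × ℂ`.
  · intro g
    obtain ⟨f, hf, rfl⟩ := exists_restr g
    change _ ∈ (polynomialToCoordRing Z).range
    have hf' := hf
    rw [isPoly_iff_mem] at hf'
    induction hf' using polyFun_induction with
    | linear l =>
      have : restr (Z ×ˢ (Set.univ : Set ℂ)) (fun p => l p) hf = polynomialToCoordRing Z
          (Polynomial.C (restr Z (fun x => l (x, 0)) (by fun_prop)) +
            Polynomial.C (restr Z (fun _ => l (0, 1)) (by fun_prop)) * Polynomial.X) := by
        refine Subtype.ext (funext fun p => ?_)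
        refine Eq.trans ?_ (polynomialToCoordRing_apply Z _ ⟨p.1.1, p.2.1⟩ p.1.2).symm
        simp only [Polynomial.map_add, Polynomial.map_mul, Polynomial.map_C, Polynomial.map_X,
          Polynomial.eval_add, Polynomial.eval_mul, Polynomial.eval_C, Polynomial.eval_X]
        change l p.1 = l (p.1.1, 0) + l (0, 1) * p.1.2
        have : p.1 = (p.1.1, 0) + p.1.2 • (0, 1) := by simp
        conv_lhs => rw [this]
        rw [map_add, map_smul, smul_eq_mul, mul_comm]
      rw [this]
      exact ⟨_, rfl⟩
    | const c => exact (polynomialToCoordRing Z).range.algebraMap_mem c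
    | add f g h1 h2 e1 e2 =>
      exact add_mem (e1 (isPoly_iff_mem.2 h1)) (e2 (isPoly_iff_mem.2 h2))
    | mul f g h1 h2 e1 e2 =>
      exact mul_mem (e1 (isPoly_iff_mem.2 h1)) (e2 (isPoly_iff_mem.2 h2))

theorem mu_prod_fun (Z : Set E) (n : ℕ) :
    mu (Z ×ˢ (Set.univ : Set (Fin n → ℂ))) = mu Z * K0Var.L ^ n := by
  induction n with
  | zero =>
    rw [pow_zero, mul_one]
    refine mu_congr Prod.fst (fun x => (x, 0)) (by fun_prop) (by fun_prop) ?_ ?_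
    · rintro ⟨x, y⟩ ⟨hx, -⟩
      exact ⟨hx, Prod.ext rfl (Subsingleton.elim _ _)⟩
    · exact fun x hx => ⟨⟨hx, trivial⟩, rfl⟩
  | succ n ih =>
    rw [pow_succ, ← mul_assoc, ← ih, ← mu_prod_line]
    have hcons : IsPoly fun p : (E × (Fin n → ℂ)) × ℂ =>
        (Fin.cons p.2 p.1.2 : Fin (n + 1) → ℂ) := by
      refine IsPoly.pi fun i => ?_
      refine Fin.cases ?_ (fun i => ?_) i
      · simp only [Fin.cons_zero]; fun_prop
      · simp only [Fin.cons_succ]; fun_prop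
    refine mu_congr (fun p => ((p.1, fun i => p.2 i.succ), p.2 0))
      (fun p => (p.1.1, Fin.cons p.2 p.1.2)) (by fun_prop) (by fun_prop) ?_ ?_
    · rintro ⟨x, y⟩ ⟨hx, -⟩
      exact ⟨⟨⟨hx, trivial⟩, trivial⟩, Prod.ext rfl (Fin.cons_self_tail y)⟩
    · rintro ⟨⟨x, y⟩, t⟩ ⟨⟨hx, -⟩, -⟩
      exact ⟨⟨hx, trivial⟩, rfl⟩

theorem mu_prod_univ (Z : Set E) :
    mu (Z ×ˢ (Set.univ : Set F)) = mu Z * K0Var.L ^ Module.finrank ℂ F := by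
  rw [← mu_prod_fun]
  let e : F ≃ₗ[ℂ] (Fin (Module.finrank ℂ F) → ℂ) := (Module.finBasis ℂ F).equivFun
  have h1 : IsPoly fun y => e y := IsPoly.linear e.toLinearMap
  have h2 : IsPoly fun y => e.symm y := IsPoly.linear e.symm.toLinearMap
  refine mu_congr (fun p => (p.1, e p.2)) (fun p => (p.1, e.symm p.2)) (by fun_prop)
    (by fun_prop) ?_ ?_
  · rintro ⟨x, y⟩ ⟨hx, -⟩
    exact ⟨⟨hx, trivial⟩, by simp⟩
  · rintro ⟨x, y⟩ ⟨hx, -⟩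
    exact ⟨⟨hx, trivial⟩, by simp⟩

theorem mu_point : mu (Set.univ : Set PUnit) = 1 := by
  rw [← specCls_complex]
  refine (specCls_congr (AlgEquiv.ofBijective (Algebra.ofId ℂ (coordRing (Set.univ : Set PUnit)))
    ⟨?_, ?_⟩)).symm
  · intro a b h
    exact congrFun (congrArg Subtype.val h) ⟨PUnit.unit, trivial⟩
  · exact fun g => ⟨g.1 ⟨PUnit.unit, trivial⟩, rfl⟩

theorem mu_univ : mu (Set.univ : Set F) = K0Var.L ^ Module.finrank ℂ F := by
  rw [← one_mul (_ ^ _), ← mu_point, ← mu_prod_univ]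
  exact mu_congr (fun x => (PUnit.unit, x)) Prod.snd (by fun_prop) (by fun_prop)
    (fun x _ => ⟨⟨trivial, trivial⟩, rfl⟩) (fun x _ => ⟨trivial, rfl⟩)

theorem mu_empty : mu (∅ : Set E) = 0 := by
  have : Subsingleton (coordRing (∅ : Set E)) :=
    ⟨fun a b => Subtype.ext (funext fun z => z.2.elim)⟩
  exact specCls_of_subsingleton _

/-- A family over `Z'` that is trivial with fibre `G` where `h' ≠ 0`; inverses of `h` and `h'` are
passed to the trivialization as an additional variable. -/
theorem mu_sub_eq_mul {G : Type} [AddCommGroup G] [Module ℂ G] [FiniteDimensional ℂ G]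
    {Z : Set E} {W : Set F} (hZ : ZClosed Z) (hW : ZClosed W) {h : E → ℂ} {k : F → ℂ}
    (hh : IsPoly h) (hk : IsPoly k) (f : E × ℂ → F × G) (g : (F × G) × ℂ → E) (hf : IsPoly f)
    (hg : IsPoly g)
    (h1 : ∀ z ∈ Z, ∀ t, h z * t = 1 →
      (f (z, t)).1 ∈ W ∧ k (f (z, t)).1 = h z ∧ g (f (z, t), t) = z)
    (h2 : ∀ w ∈ W, ∀ y t, k w * t = 1 →
      g ((w, y), t) ∈ Z ∧ h (g ((w, y), t)) = k w ∧ f (g ((w, y), t), t) = (w, y)) :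
    mu Z - mu (Z ∩ {x | h x = 0}) =
      (mu W - mu (W ∩ {x | k x = 0})) * K0Var.L ^ Module.finrank ℂ G := by
  rw [mu_eq_add hZ hh, mu_eq_add hW hk, add_sub_cancel_right, add_sub_cancel_right,
    ← mu_prod_univ]
  refine mu_congr (fun p => (((f p).1, p.2), (f p).2)) (fun p => (g ((p.1.1, p.2), p.1.2), p.1.2))
    (by fun_prop) (by fun_prop) ?_ ?_
  · rintro ⟨z, t⟩ ⟨hz, ht⟩
    obtain ⟨a, b, c⟩ := h1 z hz t ht
    exact ⟨⟨⟨a, by rw [b]; exact ht⟩, trivial⟩, Prod.ext c rfl⟩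
  · rintro ⟨⟨w, t⟩, y⟩ ⟨⟨hw, ht⟩, -⟩
    obtain ⟨a, b, c⟩ := h2 w hw y t ht
    exact ⟨⟨a, by rw [b]; exact ht⟩, by simp only [c]⟩

end MotivicClass

end

end PfaffianGrassmannian

/-! ### Families of linear systems -/

namespace PfaffianGrassmannian

noncomputable section

open Matrix

section Minors

variable {m n : Type} [Fintype m] [Fintype n]

theorem exists_linearIndependent_comp {ι V : Type} [Finite ι] [AddCommGroup V] [Module ℂ V]
    (v : ι → V) {r : ℕ} (hr : r ≤ Module.finrank ℂ (Submodule.span ℂ (Set.range v))) :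
    ∃ I : Fin r → ι, LinearIndependent ℂ (v ∘ I) := by
  have : Module.Finite ℂ (Submodule.span ℂ (Set.range v)) :=
    Module.Finite.span_of_finite ℂ (Set.finite_range v)
  obtain ⟨f, hf, -, hli⟩ := Submodule.exists_fun_fin_finrank_span_eq ℂ (Set.range v)
  choose I hI using hf
  refine ⟨fun k => I (Fin.castLE hr k), ?_⟩
  have : (v ∘ fun k => I (Fin.castLE hr k)) = f ∘ Fin.castLE hr := funext fun k => hI _
  rw [this]
  exact hli.comp _ (Fin.castLE_injective hr)

theorem exists_minor_ne_zero (A : Matrix m n ℂ) {r : ℕ} (hr : r ≤ A.rank) :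
    ∃ (I : Fin r → m) (J : Fin r → n), (A.submatrix I J).det ≠ 0 := by
  rw [rank_eq_finrank_span_row] at hr
  obtain ⟨I, hI⟩ := exists_linearIndependent_comp A.row hr
  have h1 : (A.submatrix I id).rank = r := by
    rw [LinearIndependent.rank_matrix (M := A.submatrix I id) hI, Fintype.card_fin]
  rw [rank_eq_finrank_span_cols] at h1
  obtain ⟨J, hJ⟩ := exists_linearIndependent_comp (A.submatrix I id).col h1.ge
  refine ⟨I, J, ?_⟩
  have h2 : IsUnit (A.submatrix I J) := linearIndependent_cols_iff_isUnit.1 hJ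
  exact ((isUnit_iff_isUnit_det _).1 h2).ne_zero

theorem rank_lt_iff_minors (A : Matrix m n ℂ) {r : ℕ} :
    A.rank < r ↔ ∀ (I : Fin r → m) (J : Fin r → n), (A.submatrix I J).det = 0 := by
  refine ⟨fun h I J => ?_, fun h => ?_⟩
  · by_contra hd
    have h1 := rank_of_det_ne_zero hd
    have h2 := rank_submatrix_le A I J
    rw [h1, Fintype.card_fin] at h2
    omega
  · by_contra hr
    obtain ⟨I, J, hIJ⟩ := exists_minor_ne_zero A (not_lt.1 hr)
    exact hIJ (h I J)

/-- Rows `I` that span the row space have the same kernel as the whole matrix. -/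
theorem mulVec_eq_zero_of_rank_submatrix {m : Type} {r : ℕ} (A : Matrix m n ℂ) (I : Fin r → m)
    (h : (A.submatrix I id).rank = A.rank) {d : n → ℂ} (hd : A.submatrix I id *ᵥ d = 0) :
    A *ᵥ d = 0 := by
  have hle : LinearMap.ker A.mulVecLin ≤ LinearMap.ker (A.submatrix I id).mulVecLin := by
    intro x hx
    rw [LinearMap.mem_ker, mulVecLin_apply] at hx ⊢
    exact funext fun k => congrFun hx (I k)
  have h1 := LinearMap.finrank_range_add_finrank_ker A.mulVecLin
  have h2 := LinearMap.finrank_range_add_finrank_ker (A.submatrix I id).mulVecLin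
  change A.rank + _ = _ at h1
  change (A.submatrix I id).rank + _ = _ at h2
  have := Submodule.eq_of_le_of_finrank_eq hle (by omega)
  have hd' : d ∈ LinearMap.ker (A.submatrix I id).mulVecLin := hd
  rw [← this] at hd'
  exact hd'

/-- A skew-symmetric matrix has even rank: the principal minor of a maximal independent set of rows
does not vanish. -/
theorem even_rank_of_skew {A : Matrix n n ℂ} (hA : Aᵀ = -A) : Even A.rank := by
  classical
  have hr := (rank_eq_finrank_span_row A).le
  obtain ⟨I, hI⟩ := exists_linearIndependent_comp A.row hr
  have h1 : (A.submatrix I id).rank = A.rank := by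
    rw [LinearIndependent.rank_matrix (M := A.submatrix I id) hI, Fintype.card_fin]
  have hdet : (A.submatrix I I).det ≠ 0 := by
    intro h0
    obtain ⟨x, hx, hx0⟩ := exists_mulVec_eq_zero_iff.2 h0
    apply hx
    let y : n → ℂ := ∑ k, x k • Pi.single (I k) 1
    have hy : ∀ {l : Type} [Fintype l] (B : Matrix l n ℂ), B *ᵥ y = B.submatrix id I *ᵥ x := by
      intro l _ B
      ext i
      simp only [y, mulVec, dotProduct, Finset.sum_apply, Pi.smul_apply, smul_eq_mul,
        Finset.mul_sum, submatrix_apply, id]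
      rw [Finset.sum_comm]
      refine Finset.sum_congr rfl fun k _ => ?_
      simp [Pi.single_apply]
    have h2 : A *ᵥ y = 0 := by
      refine mulVec_eq_zero_of_rank_submatrix A I h1 ?_
      rw [hy]
      exact hx0
    rw [hy] at h2
    rw [Fintype.linearIndependent_iff] at hI
    refine funext (hI x ?_)
    ext j
    have h3 := congrFun h2 j
    simp only [mulVec, dotProduct, submatrix_apply, id] at h3
    simp only [Finset.sum_apply, Pi.smul_apply, smul_eq_mul, Function.comp, row, Pi.zero_apply]
    have h4 : ∀ k, A (I k) j = - A j (I k) := fun k => congrFun (congrFun hA j) (I k)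
    simp only [h4, mul_neg, Finset.sum_neg_distrib, neg_eq_zero]
    simpa [mul_comm] using h3
  -- A skew-symmetric matrix of odd size has determinant zero.
  have hT : (A.submatrix I I)ᵀ = -A.submatrix I I := by
    rw [transpose_submatrix, hA]
    rfl
  have h3 := congrArg det hT
  rw [det_transpose, det_neg, Fintype.card_fin] at h3
  by_contra hodd
  rw [(Nat.not_even_iff_odd.1 hodd).neg_one_pow] at h3
  apply hdet
  linear_combination h3 / 2

/-- The determinant of a skew-symmetric matrix of size four is the square of its Pfaffian. -/
theorem det_fin_four_of_skew {M : Matrix (Fin 4) (Fin 4) ℂ} (hM : ∀ a b, M b a = -M a b) :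
    M.det = (M 0 1 * M 2 3 - M 0 2 * M 1 3 + M 0 3 * M 1 2) ^ 2 := by
  have h0 : ∀ a, M a a = 0 := fun a => by
    have := hM a a
    linear_combination this / 2
  simp [det_succ_row_zero, Fin.sum_univ_succ, Fin.succAbove, h0]
  rw [hM 0 1, hM 0 2, hM 0 3, hM 1 2, hM 1 3, hM 2 3]
  ring

/-- The Pfaffians of order four of a skew-symmetric matrix of rank less than four vanish. -/
theorem pfaffian_eq_zero_of_rank_lt {A : Matrix n n ℂ} (hA : Aᵀ = -A) (hr : A.rank < 4)
    (i j k l : n) : A i j * A k l - A i k * A j l + A i l * A j k = 0 := by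
  have h := (rank_lt_iff_minors A).1 hr ![i, j, k, l] ![i, j, k, l]
  rw [det_fin_four_of_skew (M := A.submatrix ![i, j, k, l] ![i, j, k, l])
    fun a b => congrFun (congrFun hA _) _] at h
  exact pow_eq_zero_iff two_ne_zero |>.1 h

end Minors

section LinearSystems

open scoped Classical

variable {m n : Type} [Fintype m] [Fintype n]

/-- The solution of a linear system with given values of the unknowns outside the columns `J`, by
Cramer's rule for the rows `I`; the scalar `t` is the inverse of the minor with rows `I` and
columns `J`. -/
def cramerSol {r : ℕ} (A : Matrix m n ℂ) (c : m → ℂ) (I : Fin r → m) (J : Fin r → n) (t : ℂ)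
    (y : {j // j ∉ Set.range J} → ℂ) : n → ℂ :=
  fun j => if h : j ∉ Set.range J then y ⟨j, h⟩ else
    ∑ k, if J k = j then t * ∑ i, (A.submatrix I J).adjugate k i *
      (c (I i) - ∑ j', A (I i) j' * if h : j' ∉ Set.range J then y ⟨j', h⟩ else 0) else 0

omit [Fintype m] in
theorem IsPoly.cramerSol {E : Type} [AddCommGroup E] [Module ℂ E] {r : ℕ} {A : E → Matrix m n ℂ}
    (hA : ∀ i j, IsPoly fun x => A x i j) {c : E → m → ℂ} (hc : IsPoly c) (I : Fin r → m)
    (J : Fin r → n) {t : E → ℂ} (ht : IsPoly t) {y : E → {j // j ∉ Set.range J} → ℂ}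
    (hy : IsPoly y) : IsPoly fun x => cramerSol (A x) (c x) I J (t x) (y x) := by
  classical
  have hadj := fun i j => IsPoly.adjugate (A := fun x => (A x).submatrix I J)
    (fun i j => hA (I i) (J j)) i j
  have hy' : ∀ j, IsPoly fun x => if h : j ∉ Set.range J then y x ⟨j, h⟩ else 0 := by
    intro j
    split_ifs <;> fun_prop
  unfold PfaffianGrassmannian.cramerSol
  refine IsPoly.pi fun j => ?_
  by_cases h : j ∈ Set.range J
  · simp only [h, not_true_eq_false, dite_false]
    refine IsPoly.sum fun k => ?_
    split_ifs <;> fun_prop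
  · simp only [h, not_false_eq_true, dite_true]
    fun_prop

variable {r : ℕ} {A : Matrix m n ℂ} {c : m → ℂ} {I : Fin r → m} {J : Fin r → n} {t : ℂ}

omit [Fintype m] [Fintype n] in
theorem injective_of_minor_ne_zero (h : (A.submatrix I J).det ≠ 0) : Function.Injective J := by
  intro a b hab
  by_contra hne
  exact h (det_zero_of_column_eq hne fun k => by simp [hab])

omit [Fintype m] in
theorem cramerSol_apply (y : {j // j ∉ Set.range J} → ℂ) (j : {j // j ∉ Set.range J}) :
    cramerSol A c I J t y j = y j := by
  rw [cramerSol, dif_pos j.2]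

theorem sum_eq_add_of_injective (hJ : Function.Injective J) (f : n → ℂ) :
    ∑ j, f j = ∑ k, f (J k) + ∑ j : {j // j ∉ Set.range J}, f j := by
  rw [← Fintype.sum_subtype_add_sum_subtype (fun j => j ∈ Set.range J) f]
  congr 1
  refine Eq.trans ?_ (Fintype.sum_equiv (Equiv.ofInjective J hJ) (fun k => f (J k))
    (fun j : Set.range J => f j) fun k => rfl).symm
  exact Finset.sum_congr (by ext; simp) fun _ _ => rfl

omit [Fintype m] in
/-- A solution of a linear system is determined by its entries outside the columns of a nonzero
minor. -/
theorem eq_of_mulVec_eq (ht : (A.submatrix I J).det ≠ 0) {b b' : n → ℂ}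
    (h : A *ᵥ b = A *ᵥ b') (hb : ∀ j : {j // j ∉ Set.range J}, b j = b' j) : b = b' := by
  have hJ := injective_of_minor_ne_zero ht
  have h1 : A.submatrix I J *ᵥ (fun k => b (J k) - b' (J k)) = 0 := by
    ext i
    have h2 := congrFun h (I i)
    simp only [mulVec, dotProduct] at h2
    rw [sum_eq_add_of_injective hJ, sum_eq_add_of_injective hJ] at h2
    simp only [hb] at h2
    simp only [mulVec, dotProduct, submatrix_apply, mul_sub, Finset.sum_sub_distrib, Pi.zero_apply]
    linear_combination h2
  have h3 := eq_zero_of_mulVec_eq_zero ht h1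
  ext j
  by_cases hj : j ∈ Set.range J
  · obtain ⟨k, rfl⟩ := hj
    exact sub_eq_zero.1 (congrFun h3 k)
  · exact hb ⟨j, hj⟩

omit [Fintype m] in
/-- Cramer's rule solves the equations of the rows `I`. As the rank is `r`, these equations imply
the others. -/
theorem mulVec_cramerSol (hr : A.rank = r)
    (ht : (A.submatrix I J).det * t = 1) (hc : ∃ b, A *ᵥ b = c)
    (y : {j // j ∉ Set.range J} → ℂ) : A *ᵥ cramerSol A c I J t y = c := by
  classical
  have hne : (A.submatrix I J).det ≠ 0 := left_ne_zero_of_mul_eq_one ht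
  have hJ := injective_of_minor_ne_zero hne
  obtain ⟨b, rfl⟩ := hc
  have hrank : (A.submatrix I id).rank = A.rank := by
    refine le_antisymm (rank_submatrix_le _ _ _) ?_
    have h1 := rank_of_det_ne_zero hne
    rw [Fintype.card_fin] at h1
    exact (hr.trans h1.symm).le.trans (rank_submatrix_le (A.submatrix I id) id J)
  let d : Fin r → ℂ := fun i => (A *ᵥ b) (I i) - ∑ j : {j // j ∉ Set.range J}, A (I i) j * y j
  have hd : ∀ i, (A *ᵥ b) (I i) - ∑ j', A (I i) j' *
      (if h : j' ∉ Set.range J then y ⟨j', h⟩ else 0) = d i := by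
    intro i
    rw [sum_eq_add_of_injective hJ]
    simp only [Set.mem_range_self, not_true_eq_false, dite_false, mul_zero, Finset.sum_const_zero,
      zero_add, d]
    congr 1
    exact Finset.sum_congr rfl fun j _ => by rw [dif_pos j.2]
  have hk : ∀ k, cramerSol A (A *ᵥ b) I J t y (J k) = (t • (A.submatrix I J).adjugate *ᵥ d) k := by
    intro k
    simp only [cramerSol, Set.mem_range_self, not_true_eq_false, dite_false, hJ.eq_iff,
      Finset.sum_ite_eq', Finset.mem_univ, if_true]
    simp only [← hd, Pi.smul_apply, smul_eq_mul, mulVec, dotProduct]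
  have h1 : A.submatrix I id *ᵥ cramerSol A (A *ᵥ b) I J t y = fun i => (A *ᵥ b) (I i) := by
    ext i
    have h2 : ((A.submatrix I J) *ᵥ (t • (A.submatrix I J).adjugate *ᵥ d)) i = d i := by
      rw [mulVec_smul, mulVec_mulVec, mul_adjugate, smul_mulVec, one_mulVec, smul_smul, mul_comm,
        ht, one_smul]
    rw [mulVec, dotProduct, sum_eq_add_of_injective hJ]
    simp only [hk, cramerSol_apply, submatrix_apply, id]
    have h3 : d i = (A *ᵥ b) (I i) - ∑ j : {j // j ∉ Set.range J}, A (I i) j * y j := rfl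
    rw [mulVec, dotProduct] at h2
    simp only [submatrix_apply] at h2
    rw [h2, h3, sub_add_cancel]
  have h2 := mulVec_eq_zero_of_rank_submatrix A I hrank
    (d := cramerSol A (A *ᵥ b) I J t y - b) (by
      rw [mulVec_sub, h1]
      ext i
      simp [mulVec, dotProduct])
  rw [mulVec_sub, sub_eq_zero] at h2
  exact h2

/-- The solutions of a linear system depending on a point `x` of `B`. -/
def linSys {E : Type} (A : E → Matrix m n ℂ) (c : E → m → ℂ) (B : Set E) : Set (E × (n → ℂ)) :=
  {p | p.1 ∈ B ∧ A p.1 *ᵥ p.2 = c p.1}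

variable {E : Type} [AddCommGroup E] [Module ℂ E] [FiniteDimensional ℂ E]

omit [FiniteDimensional ℂ E] in
theorem ZClosed.linSys {A : E → Matrix m n ℂ} (hA : ∀ i j, IsPoly fun x => A x i j)
    {c : E → m → ℂ} (hc : IsPoly c) {B : Set E} (hB : ZClosed B) : ZClosed (linSys A c B) := by
  refine (hB.preimage (IsPoly.fst IsPoly.id)).inter (ZClosed.eq (F := m → ℂ) ?_ (by fun_prop))
  unfold mulVec dotProduct
  have h : ∀ i j, IsPoly fun p : E × (n → ℂ) => A p.1 i j := fun i j =>
    (hA i j).comp (IsPoly.fst IsPoly.id)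
  fun_prop

/-- Where the minor with rows `I` and columns `J` does not vanish, the solutions of the linear
systems correspond to the values of the unknowns outside `J`. -/
theorem mu_linSys_minor {A : E → Matrix m n ℂ} (hA : ∀ i j, IsPoly fun x => A x i j)
    {c : E → m → ℂ} (hc : IsPoly c) {B : Set E} (hB : ZClosed B) {r : ℕ}
    (I : Fin r → m) (J : Fin r → n)
    (h : ∀ x ∈ B, ((A x).submatrix I J).det ≠ 0 → (A x).rank = r ∧ ∃ b, A x *ᵥ b = c x) :
    mu (linSys A c B) - mu (linSys A c (B ∩ {x | ((A x).submatrix I J).det = 0})) =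
      (mu B - mu (B ∩ {x | ((A x).submatrix I J).det = 0})) *
        K0Var.L ^ (Fintype.card n - r) := by
  classical
  by_cases hJ : Function.Injective J
  · have hdet : IsPoly fun x => ((A x).submatrix I J).det := IsPoly.det fun i j => hA _ _
    have hcard : Fintype.card n - r = Module.finrank ℂ ({j // j ∉ Set.range J} → ℂ) := by
      rw [Module.finrank_fintype_fun_eq_card, Fintype.card_subtype_compl]
      congr 1
      exact (Fintype.card_fin r).symm.trans (Fintype.card_congr (Equiv.ofInjective J hJ))
    have hset : linSys A c (B ∩ {x | ((A x).submatrix I J).det = 0}) =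
        linSys A c B ∩ {p | ((A p.1).submatrix I J).det = 0} := by
      ext p
      simp only [PfaffianGrassmannian.linSys, Set.mem_ofPred_eq, Set.mem_inter_iff]
      tauto
    have hsolp : IsPoly fun p : (E × ({j // j ∉ Set.range J} → ℂ)) × ℂ =>
        cramerSol (A p.1.1) (c p.1.1) I J p.2 p.1.2 := by
      have hfst : IsPoly fun p : (E × ({j // j ∉ Set.range J} → ℂ)) × ℂ => p.1.1 := by fun_prop
      have hA' : ∀ i j, IsPoly fun p : (E × ({j // j ∉ Set.range J} → ℂ)) × ℂ => A p.1.1 i j :=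
        fun i j => IsPoly.comp (g := fun x => A x i j) (hA i j) hfst
      have hc' : IsPoly fun p : (E × ({j // j ∉ Set.range J} → ℂ)) × ℂ => c p.1.1 := by fun_prop
      have ht' : IsPoly fun p : (E × ({j // j ∉ Set.range J} → ℂ)) × ℂ => p.2 := by fun_prop
      have hy' : IsPoly fun p : (E × ({j // j ∉ Set.range J} → ℂ)) × ℂ => p.1.2 := by fun_prop
      exact IsPoly.cramerSol hA' hc' I J ht' hy'
    rw [hset, hcard]
    refine mu_sub_eq_mul (hB.linSys hA hc) hB (hdet.comp (IsPoly.fst IsPoly.id)) hdet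
      (fun p => (p.1.1, fun j => p.1.2 j))
      (fun p => (p.1.1, cramerSol (A p.1.1) (c p.1.1) I J p.2 p.1.2)) (by fun_prop) ?_ ?_ ?_
    · exact IsPoly.prodMk (by fun_prop) hsolp
    · rintro ⟨x, b⟩ ⟨hx, hb⟩ t ht
      have hne : ((A x).submatrix I J).det ≠ 0 := left_ne_zero_of_mul_eq_one ht
      refine ⟨hx, rfl, Prod.ext rfl ?_⟩
      let y : {j // j ∉ Set.range J} → ℂ := fun j => b j
      have hb' : A x *ᵥ b = c x := hb
      have hsol : A x *ᵥ cramerSol (A x) (c x) I J t y = c x :=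
        mulVec_cramerSol (h x hx hne).1 ht (h x hx hne).2 y
      have hres : ∀ j : {j // j ∉ Set.range J}, cramerSol (A x) (c x) I J t y j = b j :=
        fun j => cramerSol_apply y j
      exact eq_of_mulVec_eq hne (hsol.trans hb'.symm) hres
    · rintro x hx y t ht
      have hne : ((A x).submatrix I J).det ≠ 0 := left_ne_zero_of_mul_eq_one ht
      have hsol : A x *ᵥ cramerSol (A x) (c x) I J t y = c x :=
        mulVec_cramerSol (h x hx hne).1 ht (h x hx hne).2 y
      have hres : (fun j : {j // j ∉ Set.range J} => cramerSol (A x) (c x) I J t y j) = y :=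
        funext fun j => cramerSol_apply y j
      exact ⟨⟨hx, hsol⟩, rfl, Prod.ext rfl hres⟩
  -- If `J` has a repetition then the minor vanishes identically.
  · have h0 : ∀ x, ((A x).submatrix I J).det = 0 := fun x => by
      by_contra h0
      exact hJ (injective_of_minor_ne_zero h0)
    simp [h0]

/-- A relation for the differences of a closed set and its parts `h i = 0` holds for the difference
with the part where all the `h i` vanish. -/
theorem sub_eq_mul_of_forall {ι : Type} (s : Finset ι) {h : ι → E → ℂ} (hh : ∀ i, IsPoly (h i))
    (Φ : Set E → K0Var) (a : K0Var) {B : Set E} (hB : ZClosed B)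
    (loc : ∀ i, ∀ B' ⊆ B, ZClosed B' →
      Φ B' - Φ (B' ∩ {x | h i x = 0}) = (mu B' - mu (B' ∩ {x | h i x = 0})) * a) :
    Φ B - Φ (B ∩ {x | ∀ i ∈ s, h i x = 0}) = (mu B - mu (B ∩ {x | ∀ i ∈ s, h i x = 0})) * a := by
  classical
  induction s using Finset.induction_on with
  | empty => simp
  | insert i s _ ih =>
    have hcl : ZClosed (B ∩ {x | ∀ i ∈ s, h i x = 0}) := by
      refine hB.inter ?_
      have := ZClosed.iInter (Z := fun i : s => {x | h i x = 0}) fun i => ZClosed.zeros (hh i)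
      simpa using this
    have h1 := loc i _ Set.inter_subset_left hcl
    have h2 : B ∩ {x | ∀ j ∈ insert i s, h j x = 0} =
        B ∩ {x | ∀ i ∈ s, h i x = 0} ∩ {x | h i x = 0} := by
      ext x
      simp only [Set.mem_inter_iff, Set.mem_ofPred_eq, Finset.forall_mem_insert]
      tauto
    rw [h2]
    linear_combination ih + h1

/-- A family of linear systems in `n` unknowns that is solvable and of rank `r` outside the locus
`B'` of rank less than `r` is a piecewise trivial affine bundle of dimension `n - r` there. -/
theorem mu_linSys {A : E → Matrix m n ℂ} (hA : ∀ i j, IsPoly fun x => A x i j)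
    {c : E → m → ℂ} (hc : IsPoly c) {B B' : Set E} (hB : ZClosed B) {r : ℕ}
    (hB' : ∀ x, x ∈ B' ↔ x ∈ B ∧ (A x).rank < r)
    (h : ∀ x ∈ B, r ≤ (A x).rank → (A x).rank = r ∧ ∃ b, A x *ᵥ b = c x) :
    mu (linSys A c B) - mu (linSys A c B') = (mu B - mu B') * K0Var.L ^ (Fintype.card n - r) := by
  classical
  have := sub_eq_mul_of_forall (Finset.univ : Finset ((Fin r → m) × (Fin r → n)))
    (h := fun p x => ((A x).submatrix p.1 p.2).det)
    (fun p => IsPoly.det fun i j => hA _ _) (fun B => mu (linSys A c B))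
    (K0Var.L ^ (Fintype.card n - r)) hB fun p B'' hB'' hcl =>
      mu_linSys_minor hA hc hcl p.1 p.2 fun x hx hne => h x (hB'' hx) (by
        have h1 := rank_of_det_ne_zero hne
        rw [Fintype.card_fin] at h1
        rw [← h1]
        exact rank_submatrix_le _ _ _)
  have h2 : B' = B ∩ {x | ∀ p ∈ (Finset.univ : Finset ((Fin r → m) × (Fin r → n))),
      ((A x).submatrix p.1 p.2).det = 0} := by
    ext x
    rw [hB', rank_lt_iff_minors]
    simp
  rw [h2]
  exact this

end LinearSystems

end

end PfaffianGrassmannian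

/-! ### Affine cells of a projective variety -/

namespace PfaffianGrassmannian

noncomputable section

open CategoryTheory AlgebraicGeometry MvPolynomial HomogeneousLocalization

attribute [local instance] MvPolynomial.gradedAlgebra

section Projective

variable {σ : Type}

theorem exists_X_notMem (P : Proj (homogeneousSubmodule σ ℂ)) :
    ∃ i, (X i : MvPolynomial σ ℂ) ∉ P.asHomogeneousIdeal := by
  by_contra! h
  refine P.not_irrelevant_le ?_
  rw [HomogeneousIdeal.irrelevant_le]
  intro n hn f hf
  have hf' : f.IsHomogeneous n := hf
  have h1 : f ∈ idealOfVars σ ℂ ^ 1 := by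
    rw [mem_pow_idealOfVars_iff]
    intro x hx
    have := hf' (mem_support_iff.1 hx)
    change Finsupp.weight (fun _ => 1) x = n at this
    rw [← Finsupp.degree_eq_weight_one] at this
    omega
  rw [pow_one] at h1
  have h2 : idealOfVars σ ℂ ≤ P.asHomogeneousIdeal.toIdeal := by
    rw [Ideal.span_le]
    rintro _ ⟨i, rfl⟩
    exact h i
  exact h2 h1

/-- The non-zero common zeros of a set of polynomials. -/
def coneZeros (s : Set (MvPolynomial σ ℂ)) : Set (σ → ℂ) := {x | x ≠ 0 ∧ ∀ f ∈ s, eval x f = 0}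

/-- The homogeneous Nullstellensatz. -/
theorem mem_projectiveClosedSet_iff [Finite σ] {s : Set (MvPolynomial σ ℂ)}
    (hs : ∀ f ∈ s, ∃ n > 0, f.IsHomogeneous n) (P : Proj (homogeneousSubmodule σ ℂ)) :
    P ∈ projectiveClosedSet (coneZeros s) ↔ ∀ f ∈ s, f ∈ P.asHomogeneousIdeal := by
  refine ⟨fun h f hf => ?_, fun h f hf => ?_⟩
  · obtain ⟨n, -, hn⟩ := hs f hf
    exact h ⟨⟨n, hn⟩, fun x hx => hx.2 f hf⟩
  · obtain ⟨⟨n, hn⟩, hfs⟩ := hf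
    obtain ⟨i, hi⟩ := exists_X_notMem P
    -- The polynomial `X i * f` vanishes also at the origin.
    have h1 : X i * f ∈ vanishingIdeal ℂ (zeroLocus ℂ (Ideal.span s)) := by
      rw [mem_vanishingIdeal_iff]
      intro x hx
      rw [zeroLocus_span] at hx
      rw [aeval_eq_eval, map_mul, eval_X]
      by_cases hx0 : x = 0
      · simp [hx0]
      · rw [hfs x ⟨hx0, fun g hg => ?_⟩, mul_zero]
        simpa [aeval_eq_eval] using hx g hg
    rw [vanishingIdeal_zeroLocus_eq_radical] at h1
    obtain ⟨k, hk⟩ := h1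
    have h2 : (X i * f) ^ k ∈ P.asHomogeneousIdeal.toIdeal :=
      (Ideal.span_le.2 fun g hg => h g hg : Ideal.span s ≤ P.asHomogeneousIdeal.toIdeal) hk
    have := P.isPrime
    exact (P.isPrime.mem_or_mem (P.isPrime.mem_of_pow_mem k h2)).resolve_left hi

variable {l : MvPolynomial σ ℂ} (hl : l ∈ (homogeneousSubmodule σ ℂ) 1)

/-- The map `x ↦ x / l` from the polynomial ring to the coordinate ring of `D₊(l)`. -/
def dehom : MvPolynomial σ ℂ →+* Away (homogeneousSubmodule σ ℂ) l :=
  eval₂Hom ((fromZeroRingHom (homogeneousSubmodule σ ℂ) _).comp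
      (algebraMap ℂ ((homogeneousSubmodule σ ℂ) 0)))
    fun i => Away.mk (homogeneousSubmodule σ ℂ) hl 1 (X i) (by simpa using isHomogeneous_X ℂ i)

theorem dehom_comp_C : (dehom hl).comp C =
    (fromZeroRingHom (homogeneousSubmodule σ ℂ) _).comp
      (algebraMap ℂ ((homogeneousSubmodule σ ℂ) 0)) := by
  ext a
  simp [dehom]

theorem val_dehom (f : MvPolynomial σ ℂ) : (dehom hl f).val = eval₂
    (algebraMap ℂ (Localization.Away l)) (fun i => Localization.mk (X i) ⟨l, 1, pow_one l⟩) f := by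
  rw [← HomogeneousLocalization.algebraMap_apply, dehom, coe_eval₂Hom,
    eval₂_comp_left]
  congr 1
  funext i
  simp only [Function.comp, HomogeneousLocalization.algebraMap_apply, Away.val_mk, pow_one]

/-- Substituting `X i / l` into a form of degree `n` divides it by `l ^ n`. -/
theorem eval₂_mul_pow_of_isHomogeneous {R : Type} [CommRing R] {k : MvPolynomial σ ℂ →+* R}
    {g : σ → R} (hg : ∀ i, g i * k l = k (X i)) {f : MvPolynomial σ ℂ} {n : ℕ}
    (hf : f.IsHomogeneous n) : eval₂ (k.comp C) g f * k l ^ n = k f := by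
  have hkf : k f = eval₂ (k.comp C) (k ∘ X) f := by rw [← eval₂_comp_left, eval₂_eta]
  rw [hkf, eval₂_eq, eval₂_eq, Finset.sum_mul]
  refine Finset.sum_congr rfl fun d hd => ?_
  have hdeg : ∑ i ∈ d.support, d i = n := by
    have := hf (mem_support_iff.1 hd)
    change Finsupp.weight (fun _ => 1) d = n at this
    rwa [← Finsupp.degree_eq_weight_one] at this
  rw [mul_assoc, ← hdeg, ← Finset.prod_pow_eq_pow_sum, ← Finset.prod_mul_distrib]
  simp only [← mul_pow, hg, Function.comp]

theorem dehom_of_isHomogeneous {f : MvPolynomial σ ℂ} {n : ℕ}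
    (hf : f ∈ (homogeneousSubmodule σ ℂ) (n • 1)) :
    dehom hl f = Away.mk (homogeneousSubmodule σ ℂ) hl n f hf := by
  apply val_injective
  rw [val_dehom, Away.val_mk, Localization.mk_eq_mk', IsLocalization.eq_mk'_iff_mul_eq, map_pow]
  refine eval₂_mul_pow_of_isHomogeneous (k := algebraMap _ (Localization.Away l)) (fun i => ?_)
    (by simpa using hf)
  exact IsLocalization.mk'_spec _ _ _

theorem dehom_surjective : Function.Surjective (dehom hl) := by
  intro x
  obtain ⟨n, f, hf, rfl⟩ := Away.mk_surjective (homogeneousSubmodule σ ℂ) hl x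
  exact ⟨f, dehom_of_isHomogeneous hl hf⟩

/-- The chart `D₊(l)` is the affine hyperplane `l = 1`. -/
theorem ker_dehom : RingHom.ker (dehom hl) = Ideal.span {l - 1} := by
  have hle : Ideal.span {l - 1} ≤ RingHom.ker (dehom hl) := by
    rw [Ideal.span_singleton_le_iff_mem, RingHom.mem_ker, map_sub, map_one, sub_eq_zero]
    rw [dehom_of_isHomogeneous hl (n := 1) (by simpa using hl)]
    apply val_injective
    rw [Away.val_mk, val_one]
    convert Localization.mk_self (⟨l ^ 1, 1, rfl⟩ : Submonoid.powers l)
    exact (pow_one l).symm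
  refine le_antisymm (fun f hf => ?_) hle
  have hl1 : Ideal.Quotient.mk (Ideal.span {l - 1}) l = 1 := by
    rw [← map_one (Ideal.Quotient.mk _), Ideal.Quotient.eq]
    exact Ideal.mem_span_singleton_self _
  let ψ : Localization.Away l →+* MvPolynomial σ ℂ ⧸ Ideal.span {l - 1} :=
    IsLocalization.Away.lift l (g := Ideal.Quotient.mk _) (by rw [hl1]; exact isUnit_one)
  have hψ : ∀ p, ψ (algebraMap _ _ p) = Ideal.Quotient.mk _ p := IsLocalization.Away.lift_eq l _
  have hval : ψ (dehom hl f).val = Ideal.Quotient.mk _ f := by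
    rw [val_dehom, eval₂_comp_left]
    conv_rhs => rw [← eval₂_eta f, eval₂_comp_left]
    congr 1
    · ext a
      exact hψ (C a)
    · funext i
      rw [Function.comp, Function.comp, ← hψ, ← mul_one (ψ _), ← hl1, ← hψ, ← map_mul,
        Localization.mk_eq_mk']
      congr 1
      exact IsLocalization.mk'_spec _ _ _
  rw [← Ideal.Quotient.eq_zero_iff_mem, ← hval, RingHom.mem_ker.1 hf, val_zero, map_zero]

theorem mem_awayι_iff (r : Spec (.of (Away (homogeneousSubmodule σ ℂ) l)))
    {f : MvPolynomial σ ℂ} {n : ℕ} (hn : 0 < n) (hf : f.IsHomogeneous n) :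
    f ∈ (Proj.awayι (homogeneousSubmodule σ ℂ) l hl one_pos r).asHomogeneousIdeal ↔
      dehom hl f ∈ r.asIdeal := by
  have hf' : f ∈ (homogeneousSubmodule σ ℂ) n := hf
  have h := congrArg (fun U => r ∈ U)
    (Proj.awayι_preimage_basicOpen (homogeneousSubmodule σ ℂ) hl one_pos hf' hn)
  have h2 : (Away.isLocalizationElem hl hf') = dehom hl f := by
    rw [dehom_of_isHomogeneous hl (n := n) (by simpa using hf)]
    simp [Away.isLocalizationElem]
  rw [h2] at h
  rw [← not_iff_not]
  exact iff_of_eq h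

/-- Restriction of polynomials to a set of points. -/
def polyToCoordRing (Z : Set (σ → ℂ)) : MvPolynomial σ ℂ →ₐ[ℂ] coordRing Z :=
  aeval fun i => restr Z (fun x => x i) (by fun_prop)

theorem polyToCoordRing_apply (Z : Set (σ → ℂ)) (p : MvPolynomial σ ℂ) (z : Z) :
    (polyToCoordRing Z p).1 z = eval z.1 p := by
  induction p using MvPolynomial.induction_on with
  | C a => rw [eval_C, ← algebraMap_eq, AlgHom.commutes]; rfl
  | add p q hp hq => rw [map_add, map_add, ← hp, ← hq]; rfl
  | mul_X p i hp =>
    rw [map_mul, map_mul, ← hp, eval_X, polyToCoordRing, aeval_X]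
    rfl

theorem polyToCoordRing_surjective [Finite σ] (Z : Set (σ → ℂ)) :
    Function.Surjective (polyToCoordRing Z) := by
  intro g
  obtain ⟨f, hf, rfl⟩ := exists_restr g
  obtain ⟨p, hp⟩ := hf.exists_eval
  refine ⟨p, Subtype.ext (funext fun z => ?_)⟩
  rw [polyToCoordRing_apply]
  exact (hp z).symm

theorem ker_polyToCoordRing (Z : Set (σ → ℂ)) :
    RingHom.ker (polyToCoordRing Z) = vanishingIdeal ℂ Z := by
  ext p
  rw [RingHom.mem_ker, mem_vanishingIdeal_iff, Subtype.ext_iff, funext_iff, Subtype.forall]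
  refine forall₂_congr fun x hx => ?_
  rw [polyToCoordRing_apply, aeval_eq_eval]
  rfl

theorem range_Spec_polyToCoordRing [Finite σ] (Z : Set (σ → ℂ)) :
    Set.range (Spec.map (CommRingCat.ofHom (polyToCoordRing Z).toRingHom)) =
      PrimeSpectrum.zeroLocus (vanishingIdeal ℂ Z : Set (MvPolynomial σ ℂ)) := by
  rw [← ker_polyToCoordRing]
  exact range_comap_of_surjective _ (polyToCoordRing Z).toRingHom (polyToCoordRing_surjective Z)

theorem coneZeros_inter_eq_zeroLocus (s : Set (MvPolynomial σ ℂ)) (hl : l.IsHomogeneous 1) :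
    coneZeros s ∩ {x | eval x l = 1} = zeroLocus ℂ (Ideal.span (insert (l - 1) s)) := by
  rw [zeroLocus_span]
  ext x
  simp only [coneZeros, Set.mem_inter_iff, Set.mem_ofPred_eq, Set.forall_mem_insert, aeval_eq_eval,
    map_sub, map_one, sub_eq_zero]
  refine ⟨fun h => ⟨h.2, h.1.2⟩, fun h => ⟨⟨?_, h.2⟩, h.1⟩⟩
  rintro rfl
  have h0 : eval 0 l = 0 := by
    rw [eval_zero, constantCoeff_eq]
    by_contra hne
    have := hl hne
    simp at this
  rw [h0] at h
  exact zero_ne_one h.1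

theorem range_subschemeι_projectiveClosedSet (S : Set (σ → ℂ)) :
    Set.range (Scheme.IdealSheafData.vanishingIdeal (projectiveClosedSet S)).subschemeι =
      projectiveClosedSet S := by
  rw [Scheme.IdealSheafData.range_subschemeι, Scheme.IdealSheafData.coe_support_vanishingIdeal]

/-- Cutting a projective variety by a hyperplane `l = 0`: the complement is the affine variety
`l = 1` on the cone. -/
theorem cls_projectiveSubvariety_eq_add [Finite σ] {s : Set (MvPolynomial σ ℂ)}
    (hs : ∀ f ∈ s, ∃ n > 0, f.IsHomogeneous n) (hl : l.IsHomogeneous 1) :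
    K0Var.cls (projectiveSubvariety (coneZeros s)) =
      mu (coneZeros s ∩ {x | eval x l = 1}) +
        K0Var.cls (projectiveSubvariety (coneZeros (insert l s))) := by
  set S1 := coneZeros s ∩ {x | eval x l = 1} with hS1
  have hl' : l ∈ homogeneousSubmodule σ ℂ 1 := hl
  have hsl : ∀ f ∈ insert l s, ∃ n > 0, f.IsHomogeneous n := by
    rw [Set.forall_mem_insert]
    exact ⟨⟨1, one_pos, hl⟩, hs⟩
  let Z := projectiveClosedSet (coneZeros s)
  let Z0 := projectiveClosedSet (coneZeros (insert l s))
  let ιZ := (Scheme.IdealSheafData.vanishingIdeal Z).subschemeι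
  let ιZ0 := (Scheme.IdealSheafData.vanishingIdeal Z0).subschemeι
  have hZ0 : ∀ P, P ∈ Z0 ↔ l ∈ P.asHomogeneousIdeal ∧ P ∈ Z := by
    intro P
    rw [mem_projectiveClosedSet_iff hsl, mem_projectiveClosedSet_iff hs, Set.forall_mem_insert]
  have hle : Z0 ≤ Z := fun P hP => ((hZ0 P).1 hP).2
  let i := Scheme.IdealSheafData.inclusion (Scheme.IdealSheafData.vanishingIdeal_antimono hle)
  have hi : i ≫ ιZ = ιZ0 := Scheme.IdealSheafData.inclusion_subschemeι _
  have hi' : IsClosedImmersion i := by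
    have : IsClosedImmersion (i ≫ ιZ) := by rw [hi]; infer_instance
    exact IsClosedImmersion.of_comp_isClosedImmersion i ιZ
  let a := Proj.awayι (homogeneousSubmodule σ ℂ) l hl' one_pos
  let β := Spec.map (CommRingCat.ofHom (dehom hl'))
  have hβ : IsClosedImmersion β := IsClosedImmersion.spec_of_surjective _ (dehom_surjective hl')
  let g := Limits.pullback.snd ιZ a ≫ β
  let f := Spec.map (CommRingCat.ofHom (polyToCoordRing S1).toRingHom)
  have hf : IsClosedImmersion f :=
    IsClosedImmersion.spec_of_surjective _ (polyToCoordRing_surjective S1)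
  have hZred : AlgebraicGeometry.IsReduced
    (Scheme.IdealSheafData.vanishingIdeal Z).subscheme := isReduced_subscheme_vanishingIdeal Z
  have hUred : AlgebraicGeometry.IsReduced (Limits.pullback ιZ a) :=
    isReduced_of_isOpenImmersion (Limits.pullback.fst ιZ a)
  have hSred : AlgebraicGeometry.IsReduced (Spec (.of (coordRing S1))) :=
    (affine_isReduced_iff (.of (coordRing S1))).mpr inferInstance
  -- The chart of the variety and the affine variety `l = 1` are closed and reduced in affine space,
  -- so it suffices to compare their underlying sets.
  have hrange : Set.range f = Set.range g := by
    refine (range_Spec_polyToCoordRing S1).trans ?_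
    rw [hS1, coneZeros_inter_eq_zeroLocus s hl, vanishingIdeal_zeroLocus_eq_radical,
      PrimeSpectrum.zeroLocus_radical, PrimeSpectrum.zeroLocus_span]
    have hmem : ∀ r, a r ∈ Z ↔ ∀ p ∈ s, dehom hl' p ∈ r.asIdeal := by
      intro r
      rw [mem_projectiveClosedSet_iff hs]
      refine forall₂_congr fun p hp => ?_
      obtain ⟨n, hn, hpn⟩ := hs p hp
      exact mem_awayι_iff hl' r hn hpn
    have hgr : Set.range g = β '' {r | a r ∈ Z} := by
      have h1 : Set.range (Limits.pullback.snd ιZ a) = {r | a r ∈ Z} := by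
        rw [Scheme.Pullback.range_snd, range_subschemeι_projectiveClosedSet]
        rfl
      rw [← h1, ← Set.range_comp]
      rfl
    rw [hgr]
    ext q
    simp only [PrimeSpectrum.mem_zeroLocus, Set.insert_subset_iff, SetLike.mem_coe]
    constructor
    · rintro ⟨hq, hsq⟩
      have h1 : q ∈ Set.range β := by
        have : Set.range β = _ := range_comap_of_surjective _ (dehom hl') (dehom_surjective hl')
        rw [this, ker_dehom, PrimeSpectrum.zeroLocus_span]
        exact Set.singleton_subset_iff.2 hq
      obtain ⟨r, rfl⟩ := h1
      exact ⟨r, (hmem r).2 fun p hp => hsq hp, rfl⟩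
    · rintro ⟨r, hr, rfl⟩
      refine ⟨?_, fun p hp => (hmem r).1 hr p hp⟩
      have h1 : dehom hl' (l - 1) = 0 := by
        rw [← RingHom.mem_ker, ker_dehom]
        exact Ideal.mem_span_singleton_self _
      change dehom hl' (l - 1) ∈ r.asIdeal
      rw [h1]
      exact zero_mem _
  obtain ⟨e, he⟩ := exists_iso_of_range_eq f g hrange
  have hj : IsOpenImmersion (e.hom ≫ Limits.pullback.fst ιZ a) := inferInstance
  refine K0Var.cls_eq_add (Z := projectiveSubvariety (coneZeros s))
    (U := affineVariety (coordRing S1)) (C := projectiveSubvariety (coneZeros (insert l s)))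
    (e.hom ≫ Limits.pullback.fst ιZ a) i ?_ ?_ hj hi' ?_
  · have h1 : a ≫ projectiveSpaceHom σ = β ≫ Spec.map (CommRingCat.ofHom (algebraMap _ _)) := by
      rw [projectiveSpaceHom, Proj.awayι_toSpecZero_assoc, ← Spec.map_comp, ← Spec.map_comp,
        ← CommRingCat.ofHom_comp, ← CommRingCat.ofHom_comp, MvPolynomial.algebraMap_eq,
        dehom_comp_C]
    have h2 : (e.hom ≫ Limits.pullback.fst ιZ a) ≫ ιZ ≫ projectiveSpaceHom σ =
        Spec.map (CommRingCat.ofHom (algebraMap ℂ (coordRing S1))) := by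
      rw [Category.assoc, Limits.pullback.condition_assoc, h1]
      change e.hom ≫ _ ≫ β ≫ _ = _
      rw [← Category.assoc (Limits.pullback.snd ιZ a), ← Category.assoc, he, ← Spec.map_comp,
        ← CommRingCat.ofHom_comp]
      congr 2
      exact RingHom.ext (polyToCoordRing S1).commutes
    exact h2
  · have h2 : i ≫ ιZ ≫ projectiveSpaceHom σ = ιZ0 ≫ projectiveSpaceHom σ := by
      rw [← Category.assoc, hi]
    exact h2
  · have h1 : Set.range i = {x | l ∈ (ιZ x).asHomogeneousIdeal} := by
      have hpt : ∀ y, ιZ (i y) = ιZ0 y := fun y => by rw [← hi]; rfl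
      ext x
      constructor
      · rintro ⟨y, rfl⟩
        have : ιZ0 y ∈ Z0 :=
          (range_subschemeι_projectiveClosedSet (coneZeros (insert l s))).le ⟨y, rfl⟩
        rw [Set.mem_ofPred_eq, hpt]
        exact ((hZ0 _).1 this).1
      · intro hx
        have hxZ : ιZ x ∈ Z := (range_subschemeι_projectiveClosedSet (coneZeros s)).le ⟨x, rfl⟩
        have hx0 : ιZ x ∈ (Z0 : Set _) := (hZ0 _).2 ⟨hx, hxZ⟩
        rw [← range_subschemeι_projectiveClosedSet (coneZeros (insert l s))] at hx0
        obtain ⟨y, hy⟩ := hx0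
        refine ⟨y, ιZ.isClosedEmbedding.injective ?_⟩
        exact (hpt y).trans hy
    have h2 : Set.range (e.hom ≫ Limits.pullback.fst ιZ a) =
        {x | l ∈ (ιZ x).asHomogeneousIdeal}ᶜ := by
      have hs : Function.Surjective e.hom := e.hom.surjective
      have : Set.range (e.hom ≫ Limits.pullback.fst ιZ a) =
          Set.range (Limits.pullback.fst ιZ a) := by
        rw [Scheme.Hom.comp_base, TopCat.coe_comp, hs.range_comp]
      rw [this, IsOpenImmersion.range_pullbackFst, Proj.opensRange_awayι]
      rfl
    refine h1.trans ?_
    refine Eq.trans ?_ (congrArg _ h2).symm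
    exact (compl_compl _).symm

theorem cls_projectiveSubvariety_empty [Finite σ] :
    K0Var.cls (projectiveSubvariety (∅ : Set (σ → ℂ))) = 0 := by
  let X := projectiveSubvariety (∅ : Set (σ → ℂ))
  have hempty : IsEmpty X.obj.left := by
    refine ⟨fun x => ?_⟩
    let P := (Scheme.IdealSheafData.vanishingIdeal
      (projectiveClosedSet (∅ : Set (σ → ℂ)))).subschemeι x
    have hP : P ∈ projectiveClosedSet (∅ : Set (σ → ℂ)) :=
      (range_subschemeι_projectiveClosedSet (∅ : Set (σ → ℂ))).le ⟨x, rfl⟩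
    obtain ⟨i, hi⟩ := exists_X_notMem P
    exact hi (hP ⟨⟨1, isHomogeneous_X ℂ i⟩, fun x hx => hx.elim⟩)
  have h := K0Var.cls_eq_add (Z := X) (U := X) (C := X) (𝟙 _) (𝟙 _) (Category.id_comp _)
    (Category.id_comp _) inferInstance inferInstance (Set.ext fun x => hempty.elim x)
  linear_combination -h

/-- A projective variety is the disjoint union of the affine varieties on which the first
non-vanishing one of given linear forms is normalized to one, if these forms have no common zero
on it. -/
theorem cls_projectiveSubvariety_eq_sum [Finite σ] {s : Set (MvPolynomial σ ℂ)}
    (hs : ∀ f ∈ s, ∃ n > 0, f.IsHomogeneous n) {l : ℕ → MvPolynomial σ ℂ}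
    (hl : ∀ k, (l k).IsHomogeneous 1) (n : ℕ)
    (hn : ∀ x ∈ coneZeros s, ∃ k < n, eval x (l k) ≠ 0) :
    K0Var.cls (projectiveSubvariety (coneZeros s)) = ∑ k ∈ Finset.range n,
      mu (coneZeros s ∩ {x | (∀ j < k, eval x (l j) = 0) ∧ eval x (l k) = 1}) := by
  have key : ∀ n, K0Var.cls (projectiveSubvariety (coneZeros s)) = ∑ k ∈ Finset.range n,
      mu (coneZeros s ∩ {x | (∀ j < k, eval x (l j) = 0) ∧ eval x (l k) = 1}) +
      K0Var.cls (projectiveSubvariety (coneZeros (s ∪ l '' {j | j < n}))) := by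
    intro n
    induction n with
    | zero => simp
    | succ n ih =>
      have hs' : ∀ f ∈ s ∪ l '' {j | j < n}, ∃ n > 0, f.IsHomogeneous n := by
        rintro f (hf | ⟨j, -, rfl⟩)
        · exact hs f hf
        · exact ⟨1, one_pos, hl j⟩
      have h1 : insert (l n) (s ∪ l '' {j | j < n}) = s ∪ l '' {j | j < n + 1} := by
        have : {j | j < n + 1} = insert n {j | j < n} := by
          ext j
          simp only [Set.mem_insert_iff, Set.mem_ofPred_eq]
          omega
        rw [this, Set.image_insert_eq, Set.union_insert]
      have h2 : coneZeros (s ∪ l '' {j | j < n}) ∩ {x | eval x (l n) = 1} =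
          coneZeros s ∩ {x | (∀ j < n, eval x (l j) = 0) ∧ eval x (l n) = 1} := by
        ext x
        simp only [coneZeros, Set.mem_inter_iff, Set.mem_ofPred_eq, Set.mem_union, or_imp,
          forall_and, Set.forall_mem_image]
        tauto
      rw [ih, cls_projectiveSubvariety_eq_add hs' (hl n), h1, h2, Finset.sum_range_succ, add_assoc]
  rw [key n]
  have : coneZeros (s ∪ l '' {j | j < n}) = ∅ := by
    rw [Set.eq_empty_iff_forall_notMem]
    intro x hx
    obtain ⟨k, hk, hne⟩ := hn x ⟨hx.1, fun f hf => hx.2 f (Or.inl hf)⟩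
    exact hne (hx.2 _ (Or.inr ⟨k, hk, rfl⟩))
  rw [this, cls_projectiveSubvariety_empty, add_zero]

end Projective

end

end PfaffianGrassmannian

/-! ### Generic families of forms without decomposable combinations -/

namespace PfaffianGrassmannian

noncomputable section

open MvPolynomial

section Generic

/-- The coordinates above the diagonal. -/
abbrev UpperIndex : Type := {p : Fin 7 × Fin 7 // p.1 < p.2}

/-- Parameters for the families of seven forms with a decomposable combination in which the form
`k` has coefficient one: the other coefficients, the other forms, and the decomposable form. -/
abbrev DecompIndex (k : Fin 7) : Type :=
  ({l // l ≠ k} ⊕ ({l // l ≠ k} × UpperIndex)) ⊕ (Fin 7 ⊕ Fin 7)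

theorem card_decompIndex (k : Fin 7) : Fintype.card (DecompIndex k) = 146 := by
  have h1 : Fintype.card {l : Fin 7 // l ≠ k} = 6 := by simp [Fintype.card_subtype_compl]
  have h2 : Fintype.card UpperIndex = 21 := by decide
  simp only [Fintype.card_sum, Fintype.card_prod, Fintype.card_fin, h1, h2]

theorem card_coordIndex : Fintype.card (Fin 7 × UpperIndex) = 147 := by
  have h2 : Fintype.card UpperIndex = 21 := by decide
  rw [Fintype.card_prod, h2, Fintype.card_fin]

/-- The coordinates of the seven forms in terms of the parameters: the form `k` is the decomposable
form minus the given combination of the others. -/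
def decompFamily (k : Fin 7) (a : Fin 7 × UpperIndex) : MvPolynomial (DecompIndex k) ℂ :=
  if h : a.1 = k then
    X (.inr (.inl a.2.1.1)) * X (.inr (.inr a.2.1.2)) -
      X (.inr (.inl a.2.1.2)) * X (.inr (.inr a.2.1.1)) -
      ∑ l : {l // l ≠ k}, X (.inl (.inl l)) * X (.inl (.inr (l, a.2)))
  else X (.inl (.inr (⟨a.1, h⟩, a.2)))

/-- There are fewer parameters than coordinates, so that the coordinates are algebraically
dependent. -/
theorem exists_relation (k : Fin 7) :
    ∃ Q : MvPolynomial (Fin 7 × UpperIndex) ℂ, Q ≠ 0 ∧ aeval (decompFamily k) Q = 0 := by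
  have h : ¬ AlgebraicIndependent ℂ (decompFamily k) := by
    intro h
    have h1 := h.cardinalMk_le_trdeg
    rw [MvPolynomial.trdeg_of_isDomain, Cardinal.lift_id, Cardinal.mk_fintype, Cardinal.mk_fintype,
      card_decompIndex, card_coordIndex] at h1
    norm_num at h1
  rw [algebraicIndependent_iff] at h
  push Not at h
  obtain ⟨Q, h1, h2⟩ := h
  exact ⟨Q, h2, h1⟩

/-- A generic family of seven skew forms has no decomposable combination. -/
theorem exists_polynomial_of_decomposable : ∃ F : MvPolynomial (Fin 7 × Fin 7 × Fin 7) ℂ,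
    (∃ w : Fin 7 → Matrix (Fin 7) (Fin 7) ℂ, (∀ k, w k ∈ skewForms) ∧
      eval (fun a => w a.1 a.2.1 a.2.2) F ≠ 0) ∧
    ∀ w : Fin 7 → Matrix (Fin 7) (Fin 7) ℂ,
      eval (fun a => w a.1 a.2.1 a.2.2) F ≠ 0 → ∀ a : Fin 7 → ℂ, a ≠ 0 → ∀ u v : Fin 7 → ℂ,
        ¬ ∀ i j, ∑ l, a l * w l i j = wedge u v (i, j) := by
  choose Q hQ hQ0 using exists_relation
  let emb : Fin 7 × UpperIndex → Fin 7 × Fin 7 × Fin 7 := fun a => (a.1, a.2.1)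
  have hF : ∀ w : Fin 7 → Matrix (Fin 7) (Fin 7) ℂ,
      eval (fun a => w a.1 a.2.1 a.2.2) (rename emb (∏ k, Q k)) =
        ∏ k, eval (fun a => w a.1 a.2.1.1 a.2.1.2) (Q k) := by
    intro w
    rw [eval_rename, map_prod]
    rfl
  refine ⟨rename emb (∏ k, Q k), ?_, fun w hw a ha u v huv => ?_⟩
  · have hne : ∏ k, Q k ≠ 0 := Finset.prod_ne_zero_iff.2 fun k _ => hQ k
    obtain ⟨x, hx⟩ : ∃ x, eval x (∏ k, Q k) ≠ 0 := by
      by_contra! h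
      exact hne (MvPolynomial.funext fun x => by rw [h x, map_zero])
    let w : Fin 7 → Matrix (Fin 7) (Fin 7) ℂ := fun l => Matrix.of fun i j =>
      if h : i < j then x (l, ⟨(i, j), h⟩) else if h : j < i then -x (l, ⟨(j, i), h⟩) else 0
    refine ⟨w, fun l => ?_, ?_⟩
    · change Matrix.transpose _ = _
      ext i j
      rcases lt_trichotomy i j with h | rfl | h
      · simp [w, h, h.not_gt]
      · simp [w]
      · simp [w, h, h.not_gt]
    · have hw : (fun a : Fin 7 × UpperIndex => w a.1 a.2.1.1 a.2.1.2) = x := by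
        funext a
        have := a.2.2
        simp [w, this]
      rw [hF, hw, ← map_prod]
      exact hx
  · rw [hF, Finset.prod_ne_zero_iff] at hw
    obtain ⟨k, hk⟩ := Function.ne_iff.1 ha
    refine hw k (Finset.mem_univ k) ?_
    let y : DecompIndex k → ℂ := Sum.elim (Sum.elim (fun l => a l / a k)
      fun p => w p.1 p.2.1.1 p.2.1.2) (Sum.elim (fun i => u i / a k) fun i => v i)
    have hy : (fun p : Fin 7 × UpperIndex => w p.1 p.2.1.1 p.2.1.2) =
        fun p => eval y (decompFamily k p) := by
      funext p
      obtain ⟨l, ⟨⟨i, j⟩, hij⟩⟩ := p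
      by_cases hl : l = k
      · subst hl
        have h1 := huv i j
        rw [← Finset.add_sum_erase _ _ (Finset.mem_univ l)] at h1
        have h2 : ∑ m : {m // m ≠ l}, a m / a l * w m i j =
            (∑ m ∈ Finset.univ.erase l, a m * w m i j) / a l := by
          rw [Finset.sum_div]
          rw [← Finset.sum_subtype (Finset.univ.erase l) (p := fun m => m ≠ l) (by simp)
            (fun m => a m / a l * w m i j)]
          exact Finset.sum_congr rfl fun m _ => by ring
        simp only [decompFamily, dite_true, map_sub, map_mul, map_sum, eval_X, y, Sum.elim_inl,
          Sum.elim_inr, h2]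
        simp only [wedge] at h1
        have hk' : a l ≠ 0 := hk
        field_simp
        linear_combination h1
      · simp [decompFamily, hl, y]
    have h3 : eval y (aeval (decompFamily k) (Q k)) = 0 := by rw [hQ0, map_zero]
    rw [aeval_def, eval₂_comp_left] at h3
    have h4 : (eval y).comp (algebraMap ℂ (MvPolynomial (DecompIndex k) ℂ)) = RingHom.id ℂ := by
      ext; simp
    rw [h4] at h3
    rw [hy]
    exact h3

end Generic

end

end PfaffianGrassmannian

/-! ### The incidence variety of pairs of vectors and forms -/

namespace PfaffianGrassmannian

noncomputable section

open Matrix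

section Kernels

variable {m n : Type} [Fintype m] [Fintype n]
  {E : Type} [AddCommGroup E] [Module ℂ E] [FiniteDimensional ℂ E]

omit [FiniteDimensional ℂ E] in
theorem ZClosed.rank_lt {A : E → Matrix m n ℂ} (hA : ∀ i j, IsPoly fun x => A x i j)
    (r : ℕ) : ZClosed {x | (A x).rank < r} := by
  simp only [rank_lt_iff_minors]
  refine ZClosed.iInter (Z := fun I : Fin r → m => {x | ∀ J : Fin r → n,
    ((A x).submatrix I J).det = 0}) fun I => ?_
  refine ZClosed.iInter (Z := fun J : Fin r → n => {x | ((A x).submatrix I J).det = 0}) fun J => ?_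
  refine ZClosed.zeros ?_
  exact IsPoly.det (A := fun x => (A x).submatrix I J) fun i j => hA _ _

/-- The kernels of a family of matrices whose rank is at most `r`, stratified by the locus `B'` of
rank less than `r`. -/
theorem mu_ker {A : E → Matrix m n ℂ} (hA : ∀ i j, IsPoly fun x => A x i j)
    {B B' : Set E} (hB : ZClosed B) {r : ℕ} (hB' : ∀ x, x ∈ B' ↔ x ∈ B ∧ (A x).rank < r)
    (h : ∀ x ∈ B, (A x).rank ≤ r) :
    mu {p : E × (n → ℂ) | p.1 ∈ B ∧ A p.1 *ᵥ p.2 = 0} =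
      (mu B - mu B') * K0Var.L ^ (Fintype.card n - r) +
        mu {p : E × (n → ℂ) | p.1 ∈ B' ∧ A p.1 *ᵥ p.2 = 0} := by
  have := mu_linSys hA (c := fun _ => 0) (IsPoly.const 0) hB hB' fun x hx hr =>
    ⟨(h x hx).antisymm hr, 0, mulVec_zero _⟩
  exact sub_eq_iff_eq_add.1 this

theorem mu_ker_of_rank_eq {A : E → Matrix m n ℂ} (hA : ∀ i j, IsPoly fun x => A x i j)
    {B : Set E} (hB : ZClosed B) {r : ℕ} (h : ∀ x ∈ B, (A x).rank = r) :
    mu {p : E × (n → ℂ) | p.1 ∈ B ∧ A p.1 *ᵥ p.2 = 0} =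
      mu B * K0Var.L ^ (Fintype.card n - r) := by
  have := mu_ker hA (B' := ∅) hB (r := r)
    (fun x => by simpa using fun hx => (h x hx).ge) fun x hx => (h x hx).le
  rw [this]
  simp [mu_empty]

/-- One linear equation with coefficients `a` and right hand side `c`, both depending on a point
of `B`, stratified by the locus `B'` where all coefficients vanish. -/
theorem mu_hyperplane {a : E → n → ℂ} (ha : IsPoly a) {c : E → ℂ} (hc : IsPoly c)
    {B B' : Set E} (hB : ZClosed B) (hB' : ∀ x, x ∈ B' ↔ x ∈ B ∧ a x = 0) :
    mu {p : E × (n → ℂ) | p.1 ∈ B ∧ a p.1 ⬝ᵥ p.2 = c p.1} =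
      (mu B - mu B') * K0Var.L ^ (Fintype.card n - 1) +
        mu {x | x ∈ B' ∧ c x = 0} * K0Var.L ^ Fintype.card n := by
  classical
  let A : E → Matrix Unit n ℂ := fun x => of fun _ j => a x j
  have hA : ∀ i j, IsPoly fun x => A x i j := fun i j => (IsPoly.apply j).comp ha
  have hrank : ∀ x, (A x).rank < 1 ↔ a x = 0 := by
    intro x
    rw [rank_lt_iff_minors]
    refine ⟨fun h => funext fun j => ?_, fun h I J => ?_⟩
    · have := h (fun _ => ()) (fun _ => j)
      rwa [det_fin_one] at this
    · rw [det_fin_one]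
      exact congrFun h _
  have key := mu_linSys hA (c := fun x _ => c x) (IsPoly.pi fun _ => hc) (r := 1) hB
    (fun x => by rw [hB', hrank]) fun x hx hr => by
      refine ⟨(rank_le_card_height _).antisymm hr, ?_⟩
      have hx0 : a x ≠ 0 := fun h0 => hr.not_gt ((hrank x).2 h0)
      obtain ⟨j, hj⟩ := Function.ne_iff.1 hx0
      refine ⟨Pi.single j (c x / a x j), ?_⟩
      ext i
      simp only [Pi.zero_apply, ne_eq] at hj
      rw [mulVec_single]
      change a x j * (c x / a x j) = c x
      field_simp
  have e1 : linSys A (fun x _ => c x) B = {p : E × (n → ℂ) | p.1 ∈ B ∧ a p.1 ⬝ᵥ p.2 = c p.1} := by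
    ext p
    exact and_congr_right fun _ => ⟨fun h => congrFun h (), fun h => funext fun _ => h⟩
  have e2 : linSys A (fun x _ => c x) B' = {x | x ∈ B' ∧ c x = 0} ×ˢ (Set.univ : Set (n → ℂ)) := by
    ext p
    simp only [Set.mem_prod, Set.mem_univ, and_true]
    refine and_congr_right fun hp => ?_
    have h0 : ∀ j, a p.1 j = 0 := congrFun ((hB' _).1 hp).2
    constructor
    · intro h
      have := congrFun h ()
      simp [A, mulVec, dotProduct, h0] at this
      exact this.symm
    · intro h
      funext i
      have h' : c p.1 = 0 := h
      simp [A, mulVec, dotProduct, h0, h']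
  rw [e1, e2, mu_prod_univ, Module.finrank_fintype_fun_eq_card] at key
  exact sub_eq_iff_eq_add.1 key

end Kernels

section Pencils

/-- The pairs of vectors on which all forms `w l` with `j ≤ l` vanish. -/
def isotropicPairs (w : Fin 7 → Matrix (Fin 7) (Fin 7) ℂ) (j : ℕ) :
    Set ((Fin 7 → ℂ) × (Fin 7 → ℂ)) :=
  {p | ∀ l : Fin 7, j ≤ l → p.1 ⬝ᵥ w l *ᵥ p.2 = 0}

/-- The normalized combinations of the forms `w k, …, w 6`. -/
def pencil (w : Fin 7 → Matrix (Fin 7) (Fin 7) ℂ) (k : Fin 7) (b : {l // k < l} → ℂ) :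
    Matrix (Fin 7) (Fin 7) ℂ :=
  w k + ∑ l : {l // k < l}, b l • w l

/-- The degenerate forms among the normalized combinations of `w k, …, w 6`. -/
def pfaffianCell (w : Fin 7 → Matrix (Fin 7) (Fin 7) ℂ) (k : Fin 7) : Set ({l // k < l} → ℂ) :=
  {b | (pencil w k b).rank < 6}

variable {w : Fin 7 → Matrix (Fin 7) (Fin 7) ℂ}

theorem card_later (k : Fin 7) : Fintype.card {l // k < l} = 6 - k := by
  rw [Fintype.card_subtype]
  have : (Finset.univ.filter fun l => k < l) = Finset.Ioi k := by ext; simp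
  rw [this, Fin.card_Ioi]

theorem isPoly_pencil (k i j) : IsPoly fun b => pencil w k b i j := by
  simp only [pencil, Matrix.add_apply, Matrix.sum_apply, Matrix.smul_apply, smul_eq_mul]
  fun_prop

theorem transpose_pencil (hw : ∀ l, (w l)ᵀ = -w l) (k : Fin 7) (b : {l // k < l} → ℂ) :
    (pencil w k b)ᵀ = -pencil w k b := by
  simp only [pencil, transpose_add, transpose_sum, transpose_smul, hw, smul_neg,
    Finset.sum_neg_distrib, neg_add]

theorem isPoly_form (A : Matrix (Fin 7) (Fin 7) ℂ) :
    IsPoly fun p : (Fin 7 → ℂ) × (Fin 7 → ℂ) => p.1 ⬝ᵥ A *ᵥ p.2 := by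
  simp only [dotProduct, mulVec]
  fun_prop

theorem form_pencil (k : Fin 7) (b : {l // k < l} → ℂ) (u v : Fin 7 → ℂ) :
    u ⬝ᵥ pencil w k b *ᵥ v = u ⬝ᵥ w k *ᵥ v + ∑ l, b l * (u ⬝ᵥ w l *ᵥ v) := by
  simp only [pencil, add_mulVec, dotProduct_add, sum_mulVec, dotProduct_sum, smul_mulVec,
    dotProduct_smul, smul_eq_mul]

theorem mu_isotropicPairs_seven : mu (isotropicPairs w 7) = K0Var.L ^ 14 := by
  have : isotropicPairs w 7 = Set.univ := by
    refine Set.eq_univ_of_forall fun p l hl => ?_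
    omega
  rw [this, mu_univ]
  simp

theorem ZClosed.isotropicPairs (j : ℕ) : ZClosed (isotropicPairs w j) := by
  refine ZClosed.iInter (Z := fun l : Fin 7 => {p : (Fin 7 → ℂ) × (Fin 7 → ℂ) | j ≤ l →
    p.1 ⬝ᵥ w l *ᵥ p.2 = 0}) fun l => ?_
  refine ZClosed.iInter (Z := fun _ : j ≤ l => {p : (Fin 7 → ℂ) × (Fin 7 → ℂ) |
    p.1 ⬝ᵥ w l *ᵥ p.2 = 0}) fun _ => ZClosed.zeros ?_
  exact isPoly_form (w l)

/-- The incidence variety of all `(u, v, b)` with `pencil w k b` vanishing on `(u, v)`. -/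
def incidence (w : Fin 7 → Matrix (Fin 7) (Fin 7) ℂ) (k : Fin 7) :
    Set (((Fin 7 → ℂ) × (Fin 7 → ℂ)) × ({l // k < l} → ℂ)) :=
  {p | p.1.1 ⬝ᵥ pencil w k p.2 *ᵥ p.1.2 = 0}

/-- Projection of the incidence variety to the pairs of vectors: the form is subject to one affine
equation, which has no solution on `isotropicPairs w (k + 1)` outside `isotropicPairs w k`. -/
theorem mu_incidence_eq_pairs (k : Fin 7) : mu (incidence w k) =
    (K0Var.L ^ 14 - mu (isotropicPairs w (k + 1))) * K0Var.L ^ (6 - k - 1 : ℕ) +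
      mu (isotropicPairs w k) * K0Var.L ^ (6 - k : ℕ) := by
  have ha : IsPoly fun (p : (Fin 7 → ℂ) × (Fin 7 → ℂ)) (l : {l // k < l}) =>
    p.1 ⬝ᵥ w l *ᵥ p.2 := IsPoly.pi fun l => isPoly_form (w l)
  have hc : IsPoly fun p : (Fin 7 → ℂ) × (Fin 7 → ℂ) => -(p.1 ⬝ᵥ w k *ᵥ p.2) :=
    (isPoly_form (w k)).neg
  have e1 := mu_hyperplane ha hc ZClosed.univ (B' := isotropicPairs w (k + 1)) (fun p => by
    simp only [Set.mem_univ, true_and, funext_iff, Pi.zero_apply, Subtype.forall]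
    rfl)
  have e2 : {x | x ∈ isotropicPairs w (k + 1) ∧ -(x.1 ⬝ᵥ w k *ᵥ x.2) = 0} =
      isotropicPairs w k := by
    ext p
    simp only [isotropicPairs, Set.mem_ofPred_eq, neg_eq_zero]
    refine ⟨fun h l hl => ?_, fun h => ⟨fun l hl => h l (by omega), h k le_rfl⟩⟩
    rcases hl.eq_or_lt with hl | hl
    · rw [← Fin.ext hl]; exact h.2
    · exact h.1 l hl
  have c1 : Module.finrank ℂ ((Fin 7 → ℂ) × (Fin 7 → ℂ)) = 14 := by simp
  have e3 : incidence w k = {p | p.1 ∈ Set.univ ∧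
      (fun l : {l // k < l} => p.1.1 ⬝ᵥ w l *ᵥ p.1.2) ⬝ᵥ p.2 = -(p.1.1 ⬝ᵥ w k *ᵥ p.1.2)} := by
    ext p
    rw [incidence, Set.mem_ofPred_eq, Set.mem_ofPred_eq, form_pencil, eq_neg_iff_add_eq_zero,
      add_comm]
    simp only [dotProduct, mul_comm, Set.mem_univ, true_and]
  rw [e2, card_later, mu_univ, c1] at e1
  rw [e3, e1]

/-- The vectors in the kernels of the forms of a pencil. -/
def kernels (w : Fin 7 → Matrix (Fin 7) (Fin 7) ℂ) (k : Fin 7) :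
    Set (({l // k < l} → ℂ) × (Fin 7 → ℂ)) :=
  {p | (pencil w k p.1)ᵀ *ᵥ p.2 = 0}

theorem finrank_later (k : Fin 7) : Module.finrank ℂ ({l // k < l} → ℂ) = 6 - k := by
  rw [Module.finrank_fintype_fun_eq_card, card_later]

/-- Projection of the incidence variety to the form and the first vector: the second vector is in
the kernel of a linear form, which is zero iff the first vector is in the kernel of the form. -/
theorem mu_incidence_eq_kernels (k : Fin 7) : mu (incidence w k) =
    (K0Var.L ^ (6 - k + 7 : ℕ) - mu (kernels w k)) * K0Var.L ^ 6 +
      mu (kernels w k) * K0Var.L ^ 7 := by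
  have e3 := mu_hyperplane (n := Fin 7) (E := ({l // k < l} → ℂ) × (Fin 7 → ℂ))
    (a := fun p => (pencil w k p.1)ᵀ *ᵥ p.2) (c := fun _ => 0) (B' := kernels w k)
    (IsPoly.pi fun i => by
      have := fun i j => (isPoly_pencil (w := w) k i j).comp
        (IsPoly.fst IsPoly.id : IsPoly fun p : ({l // k < l} → ℂ) × (Fin 7 → ℂ) => p.1)
      simp only [mulVec, dotProduct, transpose_apply]
      fun_prop) (IsPoly.const 0) ZClosed.univ (fun p => by simp [kernels])
  have e6 : mu (incidence w k) =
      mu {p : (({l // k < l} → ℂ) × (Fin 7 → ℂ)) × (Fin 7 → ℂ) | p.1 ∈ Set.univ ∧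
        ((pencil w k p.1.1)ᵀ *ᵥ p.1.2) ⬝ᵥ p.2 = 0} := by
    have key : ∀ b u v, u ⬝ᵥ pencil w k b *ᵥ v = ((pencil w k b)ᵀ *ᵥ u) ⬝ᵥ v := fun b u v => by
      rw [mulVec_transpose, ← dotProduct_mulVec]
    refine mu_congr (fun p => ((p.2, p.1.1), p.1.2)) (fun p => ((p.1.2, p.2), p.1.1))
      (by fun_prop) (by fun_prop) ?_ ?_
    · rintro ⟨⟨u, v⟩, b⟩ h
      exact ⟨⟨trivial, (key b u v).symm.trans h⟩, rfl⟩
    · rintro ⟨⟨b, u⟩, v⟩ ⟨-, h⟩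
      exact ⟨(key b u v).trans h, rfl⟩
  have c2 : Module.finrank ℂ (({l // k < l} → ℂ) × (Fin 7 → ℂ)) = 6 - k + 7 := by
    rw [Module.finrank_prod, finrank_later, Module.finrank_fintype_fun_eq_card, Fintype.card_fin]
  rw [mu_univ, c2, Fintype.card_fin] at e3
  simp only [and_true] at e3
  rw [e6, e3]
  rfl

/-- A form in the pencil has corank one, or three on the `pfaffianCell`. -/
theorem mu_kernels (hw : ∀ l, (w l)ᵀ = -w l) (k : Fin 7) (h4 : ∀ b, 4 ≤ (pencil w k b).rank) :
    mu (kernels w k) = (K0Var.L ^ (6 - k : ℕ) - mu (pfaffianCell w k)) * K0Var.L +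
      mu (pfaffianCell w k) * K0Var.L ^ 3 := by
  have hskew := transpose_pencil hw k
  have e4 := mu_ker (A := fun b => (pencil w k b)ᵀ) (fun i j => isPoly_pencil k j i)
    ZClosed.univ (r := 6) (B' := pfaffianCell w k) (fun b => by
      rw [rank_transpose]; simp [pfaffianCell]) (fun b _ => by
      rw [rank_transpose]
      have h1 := even_rank_of_skew (hskew b)
      have h2 := rank_le_card_height (pencil w k b)
      rw [Fintype.card_fin] at h2
      obtain ⟨r, hr⟩ := h1
      omega)
  have e5 := mu_ker_of_rank_eq (A := fun b => (pencil w k b)ᵀ) (fun i j => isPoly_pencil k j i)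
    (B := pfaffianCell w k) (r := 4) (ZClosed.rank_lt (fun i j => isPoly_pencil k i j) 6)
    (fun b hb => by
      rw [rank_transpose]
      obtain ⟨r, hr⟩ := even_rank_of_skew (hskew b)
      have h1 : (pencil w k b).rank < 6 := hb
      have h2 := h4 b
      omega)
  rw [mu_univ, e5, finrank_later, Fintype.card_fin] at e4
  simpa [kernels] using e4

/-- The sum over `k` of the two computations of `mu (incidence w k)`. -/
theorem mu_isotropicPairs_zero (hw : ∀ l, (w l)ᵀ = -w l)
    (h4 : ∀ k b, 4 ≤ (pencil w k b).rank) :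
    mu (isotropicPairs w 0) * K0Var.L ^ 6 = (∑ k, mu (pfaffianCell w k)) *
        (K0Var.L ^ 3 - K0Var.L) * (K0Var.L ^ 7 - K0Var.L ^ 6) +
      (∑ i ∈ Finset.range 7, K0Var.L ^ i) * (K0Var.L * (K0Var.L ^ 7 - K0Var.L ^ 6) + K0Var.L ^ 13) -
      K0Var.L ^ 14 * ∑ i ∈ Finset.range 6, K0Var.L ^ i := by
  have h : ∀ k : Fin 7, (K0Var.L ^ 14 - mu (isotropicPairs w (k + 1))) * K0Var.L ^ (6 - k - 1 : ℕ) +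
      mu (isotropicPairs w k) * K0Var.L ^ (6 - k : ℕ) =
      (K0Var.L ^ (6 - k + 7 : ℕ) - ((K0Var.L ^ (6 - k : ℕ) - mu (pfaffianCell w k)) * K0Var.L +
        mu (pfaffianCell w k) * K0Var.L ^ 3)) * K0Var.L ^ 6 +
      ((K0Var.L ^ (6 - k : ℕ) - mu (pfaffianCell w k)) * K0Var.L +
        mu (pfaffianCell w k) * K0Var.L ^ 3) * K0Var.L ^ 7 := fun k => by
    rw [← mu_kernels hw k (h4 k), ← mu_incidence_eq_pairs, ← mu_incidence_eq_kernels]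
  have h0 := h 0
  have h1 := h 1
  have h2 := h 2
  have h3 := h 3
  have h4 := h 4
  have h5 := h 5
  have h6 := h 6
  -- On the side of the pairs the sum telescopes.
  have h7 := mu_isotropicPairs_seven (w := w)
  norm_num at h0 h1 h2 h3 h4 h5 h6
  simp only [Fin.sum_univ_seven, Finset.sum_range_succ, Finset.sum_range_zero]
  linear_combination h0 + h1 + h2 + h3 + h4 + h5 + h6 + h7

end Pencils

end

end PfaffianGrassmannian

/-! ### Isotropic pairs and the Grassmannian -/

namespace PfaffianGrassmannian

noncomputable section

open Matrix

section Wedge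

theorem linearIndependent_pair_iff_wedge_ne_zero {u v : Fin 7 → ℂ} :
    LinearIndependent ℂ ![u, v] ↔ wedge u v ≠ 0 := by
  rw [LinearIndependent.pair_iff]
  refine ⟨fun h hw => ?_, fun h s t hst => ?_⟩
  · have h1 : ∀ i j, u i * v j = u j * v i := fun i j => sub_eq_zero.1 (congrFun hw (i, j))
    have h2 : ∀ i, u i = 0 := fun i => by
      have := (h (v i) (-u i) (by
        ext j
        simp only [Pi.add_apply, Pi.smul_apply, smul_eq_mul, Pi.zero_apply]
        linear_combination -h1 i j)).2
      exact neg_eq_zero.1 this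
    have := (h 1 0 (by ext j; simp [h2])).1
    exact one_ne_zero this
  · have hst' : ∀ i, s * u i + t * v i = 0 := fun i => congrFun hst i
    obtain ⟨⟨i, j⟩, hij⟩ := Function.ne_iff.1 h
    have hij' : u i * v j - u j * v i ≠ 0 := hij
    constructor
    · refine (mul_eq_zero.1 ?_).resolve_right hij'
      linear_combination v j * hst' i - v i * hst' j
    · refine (mul_eq_zero.1 ?_).resolve_right hij'
      linear_combination u i * hst' j - u j * hst' i

theorem sum_mul_wedge {A : Matrix (Fin 7) (Fin 7) ℂ} (hA : Aᵀ = -A) (u v : Fin 7 → ℂ) :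
    ∑ i, ∑ j, A i j * wedge u v (i, j) = 2 * (u ⬝ᵥ A *ᵥ v) := by
  have hA' : ∀ i j, A j i = -A i j := fun i j => congrFun (congrFun hA i) j
  have h1 : u ⬝ᵥ A *ᵥ v = ∑ i, ∑ j, A i j * (u i * v j) := by
    simp only [dotProduct, mulVec, Finset.mul_sum]
    exact Finset.sum_congr rfl fun i _ => Finset.sum_congr rfl fun j _ => by ring
  have h2 : ∑ i, ∑ j, A i j * (u j * v i) = -∑ i, ∑ j, A i j * (u i * v j) := by
    rw [Finset.sum_comm, ← Finset.sum_neg_distrib]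
    refine Finset.sum_congr rfl fun i _ => ?_
    rw [← Finset.sum_neg_distrib]
    refine Finset.sum_congr rfl fun j _ => ?_
    rw [hA' i j]
    ring
  simp only [wedge, mul_sub, Finset.sum_sub_distrib]
  rw [h2, h1]
  ring

theorem isPoly_wedge : IsPoly fun p : (Fin 7 → ℂ) × (Fin 7 → ℂ) => wedge p.1 p.2 := by
  refine IsPoly.pi fun i => ?_
  simp only [wedge]
  fun_prop

/-- The matrix of the linear map `v ↦ u ∧ v`. -/
def wedgeMatrix (u : Fin 7 → ℂ) : Matrix (Fin 7 × Fin 7) (Fin 7) ℂ :=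
  of fun p l => u p.1 * (Pi.single p.2 1 : Fin 7 → ℂ) l - u p.2 * (Pi.single p.1 1 : Fin 7 → ℂ) l

theorem wedgeMatrix_mulVec (u v : Fin 7 → ℂ) : wedgeMatrix u *ᵥ v = wedge u v := by
  ext p
  simp only [mulVec, dotProduct, wedgeMatrix, of_apply, sub_mul, Finset.sum_sub_distrib, mul_assoc,
    ← Finset.mul_sum, wedge]
  simp [Pi.single_apply]

theorem rank_wedgeMatrix {u : Fin 7 → ℂ} (hu : u ≠ 0) : (wedgeMatrix u).rank = 6 := by
  have h1 := LinearMap.finrank_range_add_finrank_ker (wedgeMatrix u).mulVecLin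
  have h2 : LinearMap.ker (wedgeMatrix u).mulVecLin = ℂ ∙ u := by
    ext v
    rw [LinearMap.mem_ker, mulVecLin_apply, wedgeMatrix_mulVec, Submodule.mem_span_singleton]
    refine ⟨fun h => ?_, ?_⟩
    · obtain ⟨i, hi⟩ := Function.ne_iff.1 hu
      have hi' : u i ≠ 0 := hi
      refine ⟨v i / u i, ?_⟩
      ext j
      have : u i * v j = u j * v i := sub_eq_zero.1 (congrFun h (i, j))
      simp only [Pi.smul_apply, smul_eq_mul]
      field_simp
      linear_combination -this
    · rintro ⟨a, rfl⟩
      ext p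
      simp only [wedge, Pi.smul_apply, smul_eq_mul, Pi.zero_apply]
      ring
  rw [h2, finrank_span_singleton hu, Module.finrank_fintype_fun_eq_card, Fintype.card_fin] at h1
  change (wedgeMatrix u).rank + 1 = 7 at h1
  omega

theorem mu_singleton_zero {E : Type} [AddCommGroup E] [Module ℂ E] [FiniteDimensional ℂ E] :
    mu ({0} : Set E) = 1 := by
  rw [← mu_point]
  refine mu_congr (fun _ => PUnit.unit) (fun _ => 0) (IsPoly.const _) (IsPoly.const _) ?_ ?_
  · rintro _ rfl
    exact ⟨trivial, rfl⟩
  · rintro w -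
    exact ⟨rfl, rfl⟩

/-- The pairs of linearly dependent vectors: any second vector for `u = 0`, a line otherwise. -/
theorem mu_wedge_eq_zero : mu {p : (Fin 7 → ℂ) × (Fin 7 → ℂ) | wedge p.1 p.2 = 0} =
    (K0Var.L ^ 7 - 1) * K0Var.L + K0Var.L ^ 7 := by
  have hA : ∀ i j, IsPoly fun u => wedgeMatrix u i j := fun i j => by
    simp only [wedgeMatrix, of_apply]
    fun_prop
  have h0 : wedgeMatrix 0 = 0 := by
    ext; simp [wedgeMatrix]
  have h1 := mu_ker hA ZClosed.univ (B' := {0}) (r := 6) (fun u => by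
      rw [Set.mem_singleton_iff]
      refine ⟨?_, fun h => by_contra fun hu => ?_⟩
      · rintro rfl
        simp [h0]
      · rw [rank_wedgeMatrix hu] at h
        exact lt_irrefl _ h.2) (fun u _ => by
      by_cases hu : u = 0
      · subst hu
        simp [h0]
      · exact (rank_wedgeMatrix hu).le)
  have h2 := mu_ker_of_rank_eq hA (B := {0}) (r := 0) (ZClosed.zeros IsPoly.id) (by
    rintro _ rfl
    simp [h0])
  rw [h2, mu_univ, mu_singleton_zero] at h1
  simpa [wedgeMatrix_mulVec] using h1

end Wedge

section Plucker

/-- The affine cone over the Grassmannian `G(2, 7)`, given by the Plücker relations, intersected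
with the linear section defined by the forms `w l`. -/
def pluckerCone (w : Fin 7 → Matrix (Fin 7) (Fin 7) ℂ) : Set (Fin 7 × Fin 7 → ℂ) :=
  {p | (∀ i j, p (j, i) = -p (i, j)) ∧
    (∀ i j k l, p (i, j) * p (k, l) - p (i, k) * p (j, l) + p (i, l) * p (j, k) = 0) ∧
    ∀ m, ∑ i, ∑ j, w m i j * p (i, j) = 0}

/-- The part of the cone where the coordinate `e n` is the first one not to vanish, and is equal
to one. -/
def pluckerCell (w : Fin 7 → Matrix (Fin 7) (Fin 7) ℂ) (e : ℕ → Fin 7 × Fin 7) (n : ℕ) :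
    Set (Fin 7 × Fin 7 → ℂ) :=
  {p | p ∈ pluckerCone w ∧ (∀ j < n, p (e j) = 0) ∧ p (e n) = 1}

/-- The isotropic pairs such that the first `n` Plücker coordinates vanish. -/
def truncatedPairs (w : Fin 7 → Matrix (Fin 7) (Fin 7) ℂ) (e : ℕ → Fin 7 × Fin 7) (n : ℕ) :
    Set ((Fin 7 → ℂ) × (Fin 7 → ℂ)) :=
  {p | p ∈ isotropicPairs w 0 ∧ ∀ j < n, wedge p.1 p.2 (e j) = 0}

variable {w : Fin 7 → Matrix (Fin 7) (Fin 7) ℂ} {e : ℕ → Fin 7 × Fin 7}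

theorem smul_wedge_mem_pluckerCone_iff (hw : ∀ l, (w l)ᵀ = -w l) {u v : Fin 7 → ℂ} {t : ℂ}
    (ht : t ≠ 0) : t • wedge u v ∈ pluckerCone w ↔ (u, v) ∈ isotropicPairs w 0 := by
  have h : ∀ m, ∑ i, ∑ j, w m i j * (t • wedge u v) (i, j) = 2 * t * (u ⬝ᵥ w m *ᵥ v) := fun m => by
    have := sum_mul_wedge (hw m) u v
    calc _ = t * ∑ i, ∑ j, w m i j * wedge u v (i, j) := by
          simp only [Finset.mul_sum, Pi.smul_apply, smul_eq_mul]
          exact Finset.sum_congr rfl fun i _ => Finset.sum_congr rfl fun j _ => by ring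
      _ = _ := by rw [this]; ring
  constructor
  · rintro ⟨-, -, h3⟩ m -
    have := (h m).symm.trans (h3 m)
    simpa [ht] using this
  · intro huv
    refine ⟨fun i j => ?_, fun i j k l => ?_, fun m => ?_⟩
    · simp only [wedge, Pi.smul_apply, smul_eq_mul]; ring
    · simp only [wedge, Pi.smul_apply, smul_eq_mul]; ring
    · rw [h m, huv m (Nat.zero_le _), mul_zero]

/-- A point of the cone over the Grassmannian is recovered from the vectors in positions `a.1` and
`a.2` of its skew matrix, where its coordinate `a` does not vanish. -/
theorem wedge_of_mem_pluckerCone {p : Fin 7 × Fin 7 → ℂ} (hp : p ∈ pluckerCone w)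
    (a : Fin 7 × Fin 7) :
    wedge (fun l => p (l, a.2)) (fun l => p (a.1, l)) = p a • p := by
  obtain ⟨h1, h2, -⟩ := hp
  ext ⟨k, l⟩
  simp only [wedge, Pi.smul_apply, smul_eq_mul]
  linear_combination p (a.1, l) * h1 k a.2 - p (a.1, k) * h1 l a.2 - h2 a.1 a.2 k l

theorem pluckerCone_diag {p : Fin 7 × Fin 7 → ℂ} (hp : p ∈ pluckerCone w) (i : Fin 7) :
    p (i, i) = 0 := self_eq_neg.1 (hp.1 i i)

theorem ZClosed.pluckerCell (n : ℕ) : ZClosed (pluckerCell w e n) := by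
  have h1 : ZClosed (pluckerCone w) := by
    refine ZClosed.inter (Y := {p : Fin 7 × Fin 7 → ℂ | ∀ i j, p (j, i) = -p (i, j)}) ?_
      (ZClosed.inter (Y := {p : Fin 7 × Fin 7 → ℂ | ∀ i j k l,
        p (i, j) * p (k, l) - p (i, k) * p (j, l) + p (i, l) * p (j, k) = 0})
      (Z := {p : Fin 7 × Fin 7 → ℂ | ∀ m, ∑ i, ∑ j, w m i j * p (i, j) = 0}) ?_ ?_)
    · have : {p : Fin 7 × Fin 7 → ℂ | ∀ i j, p (j, i) = -p (i, j)} =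
          {p | ∀ a : Fin 7 × Fin 7, p (a.2, a.1) = -p a} := by
        ext p; exact ⟨fun h a => h a.1 a.2, fun h i j => h (i, j)⟩
      rw [this]
      exact ZClosed.iInter (Z := fun a : Fin 7 × Fin 7 => {p : Fin 7 × Fin 7 → ℂ |
        p (a.2, a.1) = -p a}) fun a => ZClosed.eq (by fun_prop) (by fun_prop)
    · have : {p : Fin 7 × Fin 7 → ℂ | ∀ i j k l,
            p (i, j) * p (k, l) - p (i, k) * p (j, l) + p (i, l) * p (j, k) = 0} =
          {p | ∀ a b : Fin 7 × Fin 7,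
            p a * p b - p (a.1, b.1) * p (a.2, b.2) + p (a.1, b.2) * p (a.2, b.1) = 0} := by
        ext p; exact ⟨fun h a b => h a.1 a.2 b.1 b.2, fun h i j k l => h (i, j) (k, l)⟩
      rw [this]
      refine ZClosed.iInter (Z := fun a : Fin 7 × Fin 7 => {p : Fin 7 × Fin 7 → ℂ |
        ∀ b : Fin 7 × Fin 7,
          p a * p b - p (a.1, b.1) * p (a.2, b.2) + p (a.1, b.2) * p (a.2, b.1) = 0}) fun a => ?_
      exact ZClosed.iInter (Z := fun b : Fin 7 × Fin 7 => {p : Fin 7 × Fin 7 → ℂ |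
          p a * p b - p (a.1, b.1) * p (a.2, b.2) + p (a.1, b.2) * p (a.2, b.1) = 0})
        fun b => ZClosed.zeros (by fun_prop)
    · exact ZClosed.iInter (Z := fun m : Fin 7 => {p : Fin 7 × Fin 7 → ℂ |
        ∑ i, ∑ j, w m i j * p (i, j) = 0}) fun m => ZClosed.zeros (by fun_prop)
  refine h1.inter (ZClosed.inter (Y := {p : Fin 7 × Fin 7 → ℂ | ∀ j < n, p (e j) = 0})
    (Z := {p : Fin 7 × Fin 7 → ℂ | p (e n) = 1}) ?_ ?_)
  · refine ZClosed.iInter (Z := fun j : ℕ => {p : Fin 7 × Fin 7 → ℂ | j < n → p (e j) = 0})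
      fun j => ?_
    exact ZClosed.iInter (Z := fun _ : j < n => {p : Fin 7 × Fin 7 → ℂ | p (e j) = 0})
      fun _ => ZClosed.zeros (by fun_prop)
  · exact ZClosed.eq (by fun_prop) (by fun_prop)

theorem ZClosed.truncatedPairs (n : ℕ) : ZClosed (truncatedPairs w e n) := by
  refine (ZClosed.isotropicPairs 0).inter ?_
  refine ZClosed.iInter (Z := fun j : ℕ => {p : (Fin 7 → ℂ) × (Fin 7 → ℂ) | j < n →
    wedge p.1 p.2 (e j) = 0}) fun j => ?_
  exact ZClosed.iInter (Z := fun _ : j < n => {p : (Fin 7 → ℂ) × (Fin 7 → ℂ) |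
    wedge p.1 p.2 (e j) = 0}) fun _ => ZClosed.zeros ((IsPoly.apply (e j)).comp isPoly_wedge)

/-- The pairs of vectors with a given span form a torsor under `GL₂`, of class
`(L² - 1) (L² - L)`. Over a cell, where the Plücker coordinate `e n = (i, j)` is one, the two
vectors are determined by their coordinates `i` and `j`, which form an invertible matrix. -/
theorem mu_truncatedPairs_sub (hw : ∀ l, (w l)ᵀ = -w l) (n : ℕ) :
    mu (truncatedPairs w e n) - mu (truncatedPairs w e (n + 1)) =
      mu (pluckerCell w e n) * ((K0Var.L ^ 2 - 1) * (K0Var.L ^ 2 - K0Var.L)) := by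
  -- points of the cell, with the coordinates `i` of the two vectors
  let B : Set ((Fin 7 × Fin 7 → ℂ) × (ℂ × ℂ)) := pluckerCell w e n ×ˢ Set.univ
  let a : (Fin 7 × Fin 7 → ℂ) × (ℂ × ℂ) → Fin 2 → ℂ := fun x => ![-x.2.2, x.2.1]
  have ha : IsPoly a := IsPoly.pi fun i => by
    fin_cases i
    · change IsPoly fun x : (Fin 7 × Fin 7 → ℂ) × (ℂ × ℂ) => -x.2.2
      fun_prop
    · change IsPoly fun x : (Fin 7 × Fin 7 → ℂ) × (ℂ × ℂ) => x.2.1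
      fun_prop
  have hB : ZClosed B := by
    have := (ZClosed.pluckerCell (w := w) (e := e) n).preimage
      (IsPoly.fst IsPoly.id : IsPoly fun x : (Fin 7 × Fin 7 → ℂ) × (ℂ × ℂ) => x.1)
    convert this using 1
    ext x
    simp [B]
  have muB : mu B = mu (pluckerCell w e n) * K0Var.L ^ 2 := by
    rw [mu_prod_univ]
    simp
  have muB' : mu {x | x ∈ B ∧ a x = 0} = mu (pluckerCell w e n) := by
    refine mu_congr (fun x => x.1) (fun p => (p, 0)) (by fun_prop) (by fun_prop) ?_ ?_
    · rintro ⟨p, x, y⟩ ⟨⟨hp, -⟩, h⟩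
      have hy := congrFun h 0
      have hx := congrFun h 1
      simp only [a, Matrix.cons_val_zero, Matrix.cons_val_one, Pi.zero_apply, neg_eq_zero] at hx hy
      subst hx hy
      exact ⟨hp, rfl⟩
    · intro p hp
      refine ⟨⟨⟨hp, trivial⟩, ?_⟩, rfl⟩
      ext i
      fin_cases i <;> simp [a]
  have key := mu_hyperplane ha (IsPoly.const 0) hB
    (B' := {x | x ∈ B ∧ a x = 0}) fun x => Iff.rfl
  simp only [and_true, Set.mem_ofPred_eq] at key
  have hk : IsPoly fun p : ((Fin 7 × Fin 7 → ℂ) × (ℂ × ℂ)) × (Fin 2 → ℂ) => a p.1 ⬝ᵥ p.2 := by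
    have : (fun p : ((Fin 7 × Fin 7 → ℂ) × (ℂ × ℂ)) × (Fin 2 → ℂ) => a p.1 ⬝ᵥ p.2) =
        fun p => -p.1.2.2 * p.2 0 + p.1.2.1 * p.2 1 := by
      ext p
      simp [a, dotProduct, Fin.sum_univ_two]
    rw [this]
    fun_prop
  have hBW : ZClosed (B ×ˢ (Set.univ : Set (Fin 2 → ℂ))) := by
    have := hB.preimage (IsPoly.fst IsPoly.id : IsPoly
      fun x : ((Fin 7 × Fin 7 → ℂ) × (ℂ × ℂ)) × (Fin 2 → ℂ) => x.1)
    convert this using 1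
    ext x
    simp
  -- With `(i, j) = e n`, a pair is sent to its normalized Plücker vector `p` and its coordinates
  -- `i` and `j`. The basis of the plane of `p` dual to these coordinates is `p (·, j)`, `p (i, ·)`.
  have hf : IsPoly fun z : ((Fin 7 → ℂ) × (Fin 7 → ℂ)) × ℂ =>
      ((((z.2 • wedge z.1.1 z.1.2, (z.1.1 (e n).1, z.1.2 (e n).1)),
        ![z.1.1 (e n).2, z.1.2 (e n).2]), PUnit.unit) :
        (((Fin 7 × Fin 7 → ℂ) × (ℂ × ℂ)) × (Fin 2 → ℂ)) × PUnit) := by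
    have h2 : IsPoly fun z : ((Fin 7 → ℂ) × (Fin 7 → ℂ)) × ℂ => wedge z.1.1 z.1.2 :=
      isPoly_wedge.comp (IsPoly.fst IsPoly.id)
    have h3 : IsPoly fun z : ((Fin 7 → ℂ) × (Fin 7 → ℂ)) × ℂ =>
        (![z.1.1 (e n).2, z.1.2 (e n).2] : Fin 2 → ℂ) := IsPoly.pi fun i => by
      fin_cases i
      · change IsPoly fun z : ((Fin 7 → ℂ) × (Fin 7 → ℂ)) × ℂ => z.1.1 (e n).2
        fun_prop
      · change IsPoly fun z : ((Fin 7 → ℂ) × (Fin 7 → ℂ)) × ℂ => z.1.2 (e n).2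
        fun_prop
    fun_prop
  have hg : IsPoly fun x : ((((Fin 7 × Fin 7 → ℂ) × (ℂ × ℂ)) × (Fin 2 → ℂ)) × PUnit) × ℂ =>
      (((fun l => x.1.1.1.2.1 * x.1.1.1.1 (l, (e n).2) + x.1.1.2 0 * x.1.1.1.1 ((e n).1, l)),
      fun l => x.1.1.1.2.2 * x.1.1.1.1 (l, (e n).2) + x.1.1.2 1 * x.1.1.1.1 ((e n).1, l)) :
      (Fin 7 → ℂ) × (Fin 7 → ℂ)) := by
    refine IsPoly.prodMk (IsPoly.pi fun l => ?_) (IsPoly.pi fun l => ?_) <;> fun_prop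
  have main := mu_sub_eq_mul (G := PUnit) (ZClosed.truncatedPairs (w := w) (e := e) n) hBW
    (h := fun p => wedge p.1 p.2 (e n)) (k := fun p => a p.1 ⬝ᵥ p.2)
    ((IsPoly.apply (e n)).comp isPoly_wedge) hk
    (fun z => (((z.2 • wedge z.1.1 z.1.2, (z.1.1 (e n).1, z.1.2 (e n).1)),
      ![z.1.1 (e n).2, z.1.2 (e n).2]), PUnit.unit))
    (fun x => (fun l => x.1.1.1.2.1 * x.1.1.1.1 (l, (e n).2) + x.1.1.2 0 * x.1.1.1.1 ((e n).1, l),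
      fun l => x.1.1.1.2.2 * x.1.1.1.1 (l, (e n).2) + x.1.1.2 1 * x.1.1.1.1 ((e n).1, l)))
    hf hg ?_ ?_
  · have e1 : truncatedPairs w e n ∩ {p | wedge p.1 p.2 (e n) = 0} =
        truncatedPairs w e (n + 1) := by
      ext p
      simp only [truncatedPairs, Set.mem_inter_iff, Set.mem_ofPred_eq, and_assoc,
        Nat.lt_succ_iff_lt_or_eq, or_imp, forall_and, forall_eq]
    have e2 : B ×ˢ (Set.univ : Set (Fin 2 → ℂ)) ∩ {p | a p.1 ⬝ᵥ p.2 = 0} =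
        {p | p.1 ∈ B ∧ a p.1 ⬝ᵥ p.2 = 0} := by
      ext p
      simp
    have e3 : Module.finrank ℂ PUnit.{1} = 0 := Module.finrank_zero_of_subsingleton
    rw [e1, e2, key, muB', muB, mu_prod_univ, muB, e3, Module.finrank_fintype_fun_eq_card,
      Fintype.card_fin] at main
    rw [main]
    ring
  · rintro ⟨u, v⟩ ⟨huv, h0⟩ t ht
    have ht0 : t ≠ 0 := right_ne_zero_of_mul_eq_one ht
    simp only [wedge] at ht
    refine ⟨⟨⟨⟨(smul_wedge_mem_pluckerCone_iff hw ht0).2 huv, fun j hj => ?_, ?_⟩, trivial⟩,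
      trivial⟩, ?_, ?_⟩
    · have : wedge u v (e j) = 0 := h0 j hj
      simp [this]
    · simp only [wedge, Pi.smul_apply, smul_eq_mul]
      linear_combination ht
    · simp [a, wedge, dotProduct, Fin.sum_univ_two]
      ring
    · ext l
      · simp only [wedge, Pi.smul_apply, smul_eq_mul, Matrix.cons_val_zero]
        linear_combination u l * ht
      · simp only [wedge, Pi.smul_apply, smul_eq_mul, Matrix.cons_val_one, Matrix.cons_val_fin_one]
        linear_combination v l * ht
  · rintro ⟨⟨p, x, y⟩, r⟩ ⟨⟨⟨hp, h0, h1⟩, -⟩, -⟩ _ t ht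
    replace hp : p ∈ pluckerCone w := hp
    replace h0 : ∀ j < n, p (e j) = 0 := h0
    replace h1 : p (e n) = 1 := h1
    have hk' : a (p, x, y) ⬝ᵥ r = x * r 1 - y * r 0 := by
      simp [a, dotProduct, Fin.sum_univ_two]
      ring
    have ht0 : x * r 1 - y * r 0 ≠ 0 := hk' ▸ left_ne_zero_of_mul_eq_one ht
    have ht' : (x * r 1 - y * r 0) * t = 1 := hk' ▸ ht
    have hpw := wedge_of_mem_pluckerCone hp (e n)
    have hw' : wedge (fun l => x * p (l, (e n).2) + r 0 * p ((e n).1, l))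
        (fun l => y * p (l, (e n).2) + r 1 * p ((e n).1, l)) = (x * r 1 - y * r 0) • p := by
      ext b
      have := congrFun hpw b
      simp only [wedge, Pi.smul_apply, smul_eq_mul, h1] at this ⊢
      linear_combination (x * r 1 - y * r 0) * this
    have h1' : p ((e n).1, (e n).2) = 1 := h1
    have hd := pluckerCone_diag hp
    refine ⟨⟨?_, fun j hj => ?_⟩, ?_, ?_⟩
    · refine (smul_wedge_mem_pluckerCone_iff hw (right_ne_zero_of_mul_eq_one ht')).1 ?_
      dsimp only
      rw [hw', smul_smul, mul_comm, ht', one_smul]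
      exact hp
    · dsimp only
      rw [hw', Pi.smul_apply, h0 j hj, smul_zero]
    · dsimp only
      rw [hw', Pi.smul_apply, h1, hk', smul_eq_mul, mul_one]
    · dsimp only
      rw [hw', smul_smul, mul_comm t, ht', one_smul]
      simp only [h1', hd, mul_one, mul_zero, add_zero, zero_add]
      congr 2
      ext i
      fin_cases i <;> rfl

/-- The isotropic pairs are the bases of the planes in the linear section of the Grassmannian, and
the linearly dependent pairs. -/
theorem mu_isotropicPairs_eq_sum (hw : ∀ l, (w l)ᵀ = -w l) {N : ℕ} (he : ∀ a, ∃ n < N, e n = a) :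
    mu (isotropicPairs w 0) = (∑ n ∈ Finset.range N, mu (pluckerCell w e n)) *
      ((K0Var.L ^ 2 - 1) * (K0Var.L ^ 2 - K0Var.L)) +
      ((K0Var.L ^ 7 - 1) * K0Var.L + K0Var.L ^ 7) := by
  have h1 : truncatedPairs w e 0 = isotropicPairs w 0 := by
    ext p; simp [truncatedPairs]
  have h2 : truncatedPairs w e N = {p | wedge p.1 p.2 = 0} := by
    ext p
    refine ⟨fun h => funext fun a => ?_, fun h => ⟨fun l _ => ?_, fun j _ => ?_⟩⟩
    · obtain ⟨n, hn, rfl⟩ := he a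
      exact h.2 n hn
    · have := sum_mul_wedge (hw l) p.1 p.2
      have h' : wedge p.1 p.2 = 0 := h
      simpa [h'] using this
    · exact congrFun h _
  have h3 := Finset.sum_range_sub' (fun n => mu (truncatedPairs w e n)) N
  simp only [mu_truncatedPairs_sub hw, ← Finset.sum_mul] at h3
  rw [h1, h2, mu_wedge_eq_zero] at h3
  linear_combination -h3

end Plucker

end

end PfaffianGrassmannian

/-! ### Cells of the two varieties and the comparison -/

namespace PfaffianGrassmannian

noncomputable section

open Matrix MvPolynomial

section VarietyX

variable {w : Fin 7 → Matrix (Fin 7) (Fin 7) ℂ}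

/-- The equations of the Grassmannian in its Plücker embedding and of the linear section. -/
def pluckerEquations (w : Fin 7 → Matrix (Fin 7) (Fin 7) ℂ) :
    Set (MvPolynomial (Fin 7 × Fin 7) ℂ) :=
  {f | (∃ i j, f = X (j, i) + X (i, j)) ∨
    (∃ i j k l, f = X (i, j) * X (k, l) - X (i, k) * X (j, l) + X (i, l) * X (j, k)) ∨
    ∃ m, f = ∑ i, ∑ j, C (w m i j) * X (i, j)}

theorem isHomogeneous_of_mem_pluckerEquations {f : MvPolynomial (Fin 7 × Fin 7) ℂ}
    (hf : f ∈ pluckerEquations w) : ∃ n > 0, f.IsHomogeneous n := by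
  obtain ⟨i, j, rfl⟩ | ⟨i, j, k, l, rfl⟩ | ⟨m, rfl⟩ := hf
  · exact ⟨1, one_pos, (isHomogeneous_X _ _).add (isHomogeneous_X _ _)⟩
  · exact ⟨2, two_pos, (((isHomogeneous_X _ _).mul (isHomogeneous_X _ _)).sub
      ((isHomogeneous_X _ _).mul (isHomogeneous_X _ _))).add
      ((isHomogeneous_X _ _).mul (isHomogeneous_X _ _))⟩
  · refine ⟨1, one_pos, IsHomogeneous.sum _ _ _ fun i _ => IsHomogeneous.sum _ _ _ fun j _ => ?_⟩
    simpa using (isHomogeneous_C _ (w m i j)).mul (isHomogeneous_X ℂ (i, j))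

theorem mem_coneZeros_pluckerEquations {p : Fin 7 × Fin 7 → ℂ} :
    p ∈ coneZeros (pluckerEquations w) ↔ p ≠ 0 ∧ p ∈ pluckerCone w := by
  refine and_congr_right fun _ => ⟨fun h => ⟨fun i j => ?_, fun i j k l => ?_, fun m => ?_⟩, ?_⟩
  · have := h _ (Or.inl ⟨i, j, rfl⟩)
    simpa [add_eq_zero_iff_eq_neg] using this
  · have := h _ (Or.inr (Or.inl ⟨i, j, k, l, rfl⟩))
    simpa using this
  · have := h _ (Or.inr (Or.inr ⟨m, rfl⟩))
    simpa using this
  · rintro ⟨h1, h2, h3⟩ f (⟨i, j, rfl⟩ | ⟨i, j, k, l, rfl⟩ | ⟨m, rfl⟩)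
    · simp [h1 i j]
    · simpa using h2 i j k l
    · simpa using h3 m

/-- The Plücker relations and the linear equations cut out the planes on which `W` vanishes. -/
theorem varietyX_eq (hw : ∀ l, (w l)ᵀ = -w l) :
    varietyX (Submodule.span ℂ (Set.range w)) =
      projectiveSubvariety (coneZeros (pluckerEquations w)) := by
  have : {p | ∃ u v : Fin 7 → ℂ, LinearIndependent ℂ ![u, v] ∧
      (∀ a ∈ Submodule.span ℂ (Set.range w), u ⬝ᵥ a *ᵥ v = 0) ∧ p = wedge u v} =
      coneZeros (pluckerEquations w) := by
    ext p
    rw [mem_coneZeros_pluckerEquations]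
    constructor
    · rintro ⟨u, v, h1, h2, rfl⟩
      refine ⟨linearIndependent_pair_iff_wedge_ne_zero.1 h1, ?_⟩
      rw [← one_smul ℂ (wedge u v), smul_wedge_mem_pluckerCone_iff hw one_ne_zero]
      exact fun l _ => h2 _ (Submodule.subset_span ⟨l, rfl⟩)
    · rintro ⟨h0, hp⟩
      obtain ⟨a, ha⟩ := Function.ne_iff.1 h0
      have ha' : p a ≠ 0 := ha
      have h1 := wedge_of_mem_pluckerCone hp a
      have h2 : wedge ((p a)⁻¹ • fun l => p (l, a.2)) (fun l => p (a.1, l)) = p := by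
        ext b
        have := congrFun h1 b
        simp only [wedge, Pi.smul_apply, smul_eq_mul] at this ⊢
        field_simp
        linear_combination this
      refine ⟨_, _, linearIndependent_pair_iff_wedge_ne_zero.2 (by rwa [h2]), fun b hb => ?_,
        h2.symm⟩
      rw [← h2, ← one_smul ℂ (wedge _ _), smul_wedge_mem_pluckerCone_iff hw one_ne_zero] at hp
      obtain ⟨c, rfl⟩ := (Submodule.mem_span_range_iff_exists_fun ℂ).1 hb
      rw [sum_mulVec, dotProduct_sum]
      refine Finset.sum_eq_zero fun l _ => ?_
      rw [smul_mulVec, dotProduct_smul, hp l (Nat.zero_le _), smul_zero]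
  rw [varietyX, this]

theorem exists_enumeration : ∃ e : ℕ → Fin 7 × Fin 7, ∀ a, ∃ n < 49, e n = a := by
  refine ⟨fun n => finProdFinEquiv.symm (Fin.ofNat 49 n), fun a => ?_⟩
  refine ⟨finProdFinEquiv a, (finProdFinEquiv a).2, ?_⟩
  rw [Equiv.symm_apply_eq]
  exact Fin.ext (Nat.mod_eq_of_lt (finProdFinEquiv a).2)

/-- The cell decomposition of `X_W` induced by the standard one of projective space. -/
theorem cls_varietyX (hw : ∀ l, (w l)ᵀ = -w l) {e : ℕ → Fin 7 × Fin 7} {N : ℕ}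
    (he : ∀ a, ∃ n < N, e n = a) :
    K0Var.cls (varietyX (Submodule.span ℂ (Set.range w))) =
      ∑ n ∈ Finset.range N, mu (pluckerCell w e n) := by
  rw [varietyX_eq hw]
  refine (cls_projectiveSubvariety_eq_sum (fun f => isHomogeneous_of_mem_pluckerEquations)
    (l := fun n => X (e n)) (fun n => isHomogeneous_X _ _) N fun x hx => ?_).trans ?_
  · obtain ⟨a, ha⟩ := Function.ne_iff.1 hx.1
    obtain ⟨n, hn, rfl⟩ := he a
    exact ⟨n, hn, by simpa using ha⟩
  · refine Finset.sum_congr rfl fun n _ => congrArg mu ?_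
    ext p
    simp only [Set.mem_inter_iff, mem_coneZeros_pluckerEquations, pluckerCell, Set.mem_ofPred_eq,
      eval_X]
    refine ⟨fun h => ⟨h.1.2, h.2⟩, fun h => ⟨⟨fun h0 => ?_, h.1⟩, h.2⟩⟩
    have := h.2.2
    rw [h0] at this
    exact zero_ne_one this

end VarietyX

section VarietyY

/-- A minor of the generic `7 × 7` matrix. -/
def minorPoly (I J : Fin 6 → Fin 7) : MvPolynomial (Fin 7 × Fin 7) ℂ :=
  (of fun a b => X (I a, J b) : Matrix (Fin 6) (Fin 6) (MvPolynomial (Fin 7 × Fin 7) ℂ)).det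

theorem isHomogeneous_minorPoly (I J : Fin 6 → Fin 7) : (minorPoly I J).IsHomogeneous 6 := by
  rw [minorPoly, det_apply]
  refine IsHomogeneous.sum _ _ _ fun s _ => ?_
  have h := IsHomogeneous.prod (R := ℂ) Finset.univ
    (fun i : Fin 6 => (X (I (s i), J i) : MvPolynomial (Fin 7 × Fin 7) ℂ)) (fun _ => 1)
    fun i _ => isHomogeneous_X _ _
  rw [Finset.sum_const, Finset.card_univ, Fintype.card_fin] at h
  exact (homogeneousSubmodule _ ℂ 6).toAddSubgroup.zsmul_mem h _

theorem eval_minorPoly (I J : Fin 6 → Fin 7) (x : Fin 7 × Fin 7 → ℂ) :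
    eval x (minorPoly I J) = ((of fun i j => x (i, j)).submatrix I J).det := by
  rw [minorPoly, RingHom.map_det]
  congr 1
  ext a b
  simp

variable {w : Fin 7 → Matrix (Fin 7) (Fin 7) ℂ}

theorem sum_eq_pencil {k : Fin 7} {a : Fin 7 → ℂ} (h0 : ∀ l < k, a l = 0) (h1 : a k = 1) :
    ∑ l, a l • w l = pencil w k fun l => a l := by
  rw [← Finset.add_sum_erase _ _ (Finset.mem_univ k), h1, one_smul, pencil]
  congr 1
  rw [← Finset.sum_subtype (Finset.Ioi k) (by simp) fun l => a l • w l]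
  symm
  refine Finset.sum_subset (fun l hl => ?_) fun l hl hl' => ?_
  · simp only [Finset.mem_Ioi] at hl
    simp [hl.ne']
  · simp only [Finset.mem_erase, Finset.mem_univ, and_true, Finset.mem_Ioi, not_lt] at hl hl'
    rw [h0 l (lt_of_le_of_ne hl' hl), zero_smul]

/-- The coefficients of a normalized combination. -/
def pencilCoeff (k : Fin 7) (b : {l // k < l} → ℂ) (l : Fin 7) : ℂ :=
  if h : k < l then b ⟨l, h⟩ else if l = k then 1 else 0

theorem pencilCoeff_of_lt {k l : Fin 7} (b : {l // k < l} → ℂ) (h : l < k) :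
    pencilCoeff k b l = 0 := by
  simp [pencilCoeff, h.not_gt, h.ne]

theorem pencilCoeff_self (k : Fin 7) (b : {l // k < l} → ℂ) : pencilCoeff k b k = 1 := by
  simp [pencilCoeff]

theorem pencilCoeff_coe {k : Fin 7} (b : {l // k < l} → ℂ) (l : {l // k < l}) :
    pencilCoeff k b l = b l := by
  simp [pencilCoeff, l.2]

theorem pencil_eq_sum (k : Fin 7) (b : {l // k < l} → ℂ) :
    pencil w k b = ∑ l, pencilCoeff k b l • w l := by
  rw [sum_eq_pencil (fun l => pencilCoeff_of_lt b) (pencilCoeff_self k b)]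
  congr 1
  ext l
  rw [pencilCoeff_coe]

/-- The coordinates on the span of linearly independent matrices, extended to all matrices. -/
theorem exists_coordinates (hli : LinearIndependent ℂ w) :
    ∃ S : (Fin 7 × Fin 7 → ℂ) →ₗ[ℂ] (Fin 7 → ℂ),
      ∀ a, S (fun ij => (∑ l, a l • w l) ij.1 ij.2) = a := by
  let T : (Fin 7 → ℂ) →ₗ[ℂ] (Fin 7 × Fin 7 → ℂ) :=
    Fintype.linearCombination ℂ fun l ij => w l ij.1 ij.2
  have hT : ∀ a, T a = fun ij => (∑ l, a l • w l) ij.1 ij.2 := fun a => by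
    ext ij
    simp [T, Fintype.linearCombination_apply, Matrix.sum_apply]
  obtain ⟨S, hS⟩ := T.exists_leftInverse_of_injective (LinearMap.ker_eq_bot'.2 fun a ha => by
    rw [hT] at ha
    have : ∑ l, a l • w l = 0 := by
      ext i j
      exact congrFun ha (i, j)
    exact funext (Fintype.linearIndependent_iff.1 hli a this))
  exact ⟨S, fun a => by rw [← hT]; exact LinearMap.congr_fun hS a⟩

/-- The equations `x = ∑ l, S x l • w l` of the span of the `w l`, for coordinates `S` on it, and
the minors of order six. -/
def pfaffianEquations (w : Fin 7 → Matrix (Fin 7) (Fin 7) ℂ)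
    (S : (Fin 7 × Fin 7 → ℂ) →ₗ[ℂ] (Fin 7 → ℂ)) : Set (MvPolynomial (Fin 7 × Fin 7) ℂ) :=
  {f | (∃ ij, f = linPoly (LinearMap.proj ij -
      (Fintype.linearCombination ℂ fun l => w l ij.1 ij.2) ∘ₗ S)) ∨ ∃ I J, f = minorPoly I J}

theorem mem_coneZeros_pfaffianEquations {S : (Fin 7 × Fin 7 → ℂ) →ₗ[ℂ] (Fin 7 → ℂ)}
    {x : Fin 7 × Fin 7 → ℂ} : x ∈ coneZeros (pfaffianEquations w S) ↔
      x ≠ 0 ∧ (of fun i j => x (i, j)) = ∑ l, S x l • w l ∧ (of fun i j => x (i, j)).rank < 6 := by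
  have key : ∀ ij, eval x (linPoly (LinearMap.proj ij -
      (Fintype.linearCombination ℂ fun l => w l ij.1 ij.2) ∘ₗ S)) =
      x ij - (∑ l, S x l • w l) ij.1 ij.2 := fun ij => by
    rw [eval_linPoly]
    simp [Fintype.linearCombination_apply, Matrix.sum_apply]
  refine and_congr_right fun _ => ⟨fun h => ⟨?_, ?_⟩, ?_⟩
  · ext i j
    have := h _ (Or.inl ⟨(i, j), rfl⟩)
    rw [key] at this
    exact sub_eq_zero.1 this
  · rw [rank_lt_iff_minors]
    intro I J
    rw [← eval_minorPoly]
    exact h _ (Or.inr ⟨I, J, rfl⟩)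
  · rintro ⟨h1, h2⟩ f (⟨ij, rfl⟩ | ⟨I, J, rfl⟩)
    · rw [key, ← h1]
      exact sub_self _
    · rw [eval_minorPoly]
      exact (rank_lt_iff_minors _).1 h2 I J

theorem varietyY_eq {S : (Fin 7 × Fin 7 → ℂ) →ₗ[ℂ] (Fin 7 → ℂ)}
    (hS : ∀ a, S (fun ij => (∑ l, a l • w l) ij.1 ij.2) = a) :
    varietyY (Submodule.span ℂ (Set.range w)) =
      projectiveSubvariety (coneZeros (pfaffianEquations w S)) := by
  have : {p : Fin 7 × Fin 7 → ℂ | ∃ a ∈ Submodule.span ℂ (Set.range w), a ≠ 0 ∧ a.rank < 6 ∧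
      p = fun ij => a ij.1 ij.2} = coneZeros (pfaffianEquations w S) := by
    ext p
    rw [mem_coneZeros_pfaffianEquations]
    constructor
    · rintro ⟨a, ha, h0, hr, rfl⟩
      refine ⟨fun h => h0 ?_, ?_, hr⟩
      · ext i j
        exact congrFun h (i, j)
      · obtain ⟨c, rfl⟩ := (Submodule.mem_span_range_iff_exists_fun ℂ).1 ha
        rw [hS]
        rfl
    · rintro ⟨h0, h1, h2⟩
      refine ⟨of fun i j => p (i, j), ?_, fun h => h0 ?_, h2, rfl⟩
      · rw [h1]
        exact (Submodule.mem_span_range_iff_exists_fun ℂ).2 ⟨_, rfl⟩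
      · ext ij
        exact congrFun (congrFun h ij.1) ij.2
  rw [varietyY, this]

/-- The cell decomposition of `Y_W` induced by the one of the projective space of `W` given by the
basis `w`. -/
theorem cls_varietyY (hli : LinearIndependent ℂ w) :
    K0Var.cls (varietyY (Submodule.span ℂ (Set.range w))) = ∑ k, mu (pfaffianCell w k) := by
  obtain ⟨S, hS⟩ := exists_coordinates hli
  rw [varietyY_eq hS]
  let l : ℕ → MvPolynomial (Fin 7 × Fin 7) ℂ := fun n =>
    if h : n < 7 then linPoly (LinearMap.proj ⟨n, h⟩ ∘ₗ S) else 0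
  have hl : ∀ (k : Fin 7) x, eval x (l k) = S x k := fun k x => by
    simp [l, eval_linPoly]
  refine (cls_projectiveSubvariety_eq_sum (l := l) ?_ (fun n => ?_) 7 fun x hx => ?_).trans ?_
  · rintro f (⟨ij, rfl⟩ | ⟨I, J, rfl⟩)
    · exact ⟨1, one_pos, isHomogeneous_linPoly _⟩
    · exact ⟨6, by norm_num, isHomogeneous_minorPoly I J⟩
  · by_cases h : n < 7
    · simp only [l, h, dite_true]
      exact isHomogeneous_linPoly _
    · simp only [l, h, dite_false]
      exact isHomogeneous_zero _ _ _
  · rw [mem_coneZeros_pfaffianEquations] at hx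
    by_contra! h
    refine hx.1 ?_
    have h0 : ∀ k : Fin 7, S x k = 0 := fun k => by rw [← hl]; exact h k k.2
    have h1 := hx.2.1
    simp only [h0, zero_smul, Finset.sum_const_zero] at h1
    ext ij
    exact congrFun (congrFun h1 ij.1) ij.2
  · rw [Finset.sum_range]
    refine Finset.sum_congr rfl fun k _ => ?_
    refine mu_congr (fun x l => S x l) (fun b ij => pencil w k b ij.1 ij.2)
      (IsPoly.pi fun l => IsPoly.linear (LinearMap.proj l.1 ∘ₗ S))
      (IsPoly.pi fun ij => isPoly_pencil k _ _) ?_ ?_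
    · rintro x ⟨hx, h0, h1⟩
      rw [mem_coneZeros_pfaffianEquations] at hx
      rw [hl] at h1
      have h0' : ∀ j < k, S x j = 0 := fun j hj => by rw [← hl]; exact h0 j hj
      have h2 := hx.2.1
      rw [sum_eq_pencil h0' h1] at h2
      refine ⟨?_, ?_⟩
      · have := hx.2.2
        rw [h2] at this
        exact this
      · ext ij
        exact (congrFun (congrFun h2 ij.1) ij.2).symm
    · intro b hb
      have h1 : S (fun ij => pencil w k b ij.1 ij.2) = pencilCoeff k b := by
        rw [pencil_eq_sum]
        exact hS _
      refine ⟨⟨?_, fun j hj => ?_, ?_⟩, ?_⟩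
      · rw [mem_coneZeros_pfaffianEquations, h1, ← pencil_eq_sum]
        refine ⟨fun h0 => ?_, rfl, hb⟩
        rw [h0, map_zero] at h1
        have := congrFun h1 k
        rw [pencilCoeff_self] at this
        exact zero_ne_one this
      · have := hl ⟨j, hj.trans k.2⟩
        rw [this, h1]
        exact pencilCoeff_of_lt b hj
      · rw [hl, h1, pencilCoeff_self]
      · ext l
        rw [h1, pencilCoeff_coe]

end VarietyY

section Main

variable {w : Fin 7 → Matrix (Fin 7) (Fin 7) ℂ}

/-- A skew form of rank less than four is decomposable. -/
theorem exists_wedge_of_rank_lt {A : Matrix (Fin 7) (Fin 7) ℂ} (hA : Aᵀ = -A) (hr : A.rank < 4) :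
    ∃ u v, ∀ i j, A i j = wedge u v (i, j) := by
  by_cases h0 : A = 0
  · exact ⟨0, 0, fun i j => by simp [h0, wedge]⟩
  have hp : (fun ij : Fin 7 × Fin 7 => A ij.1 ij.2) ∈ pluckerCone (fun _ => 0) :=
    ⟨fun i j => congrFun (congrFun hA i) j,
      fun i j k l => pfaffian_eq_zero_of_rank_lt hA hr i j k l, fun m => by simp⟩
  obtain ⟨i, j, hij⟩ : ∃ i j, A i j ≠ 0 := by
    by_contra! h
    exact h0 (by ext i j; exact h i j)
  refine ⟨(A i j)⁻¹ • fun l => A l j, fun l => A i l, fun k l => ?_⟩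
  have := congrFun (wedge_of_mem_pluckerCone hp (i, j)) (k, l)
  simp only [wedge, Pi.smul_apply, smul_eq_mul] at this ⊢
  field_simp
  linear_combination -this

theorem rank_pencil_ge (hw : ∀ l, (w l)ᵀ = -w l)
    (hdec : ∀ a : Fin 7 → ℂ, a ≠ 0 → ∀ u v : Fin 7 → ℂ,
      ¬ ∀ i j, ∑ l, a l * w l i j = wedge u v (i, j)) (k : Fin 7) (b : {l // k < l} → ℂ) :
    4 ≤ (pencil w k b).rank := by
  by_contra! h
  obtain ⟨u, v, huv⟩ := exists_wedge_of_rank_lt (transpose_pencil hw k b) h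
  refine hdec (pencilCoeff k b) (fun h0 => ?_) u v fun i j => ?_
  · have := pencilCoeff_self k b
    rw [h0] at this
    exact zero_ne_one this
  · rw [← huv, pencil_eq_sum]
    simp [Matrix.sum_apply]

/-- The comparison of classes for a space of forms without nonzero decomposable ones. -/
theorem cls_sub_mul_eq_zero (hw : ∀ l, (w l)ᵀ = -w l) (hli : LinearIndependent ℂ w)
    (hrank : ∀ k b, 4 ≤ (pencil w k b).rank) :
    (K0Var.cls (varietyX (Submodule.span ℂ (Set.range w))) -
      K0Var.cls (varietyY (Submodule.span ℂ (Set.range w)))) * (K0Var.L ^ 2 - 1) * (K0Var.L - 1) *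
      K0Var.L ^ 7 = 0 := by
  obtain ⟨e, he⟩ := exists_enumeration
  have h1 := mu_isotropicPairs_eq_sum hw he
  have h2 := mu_isotropicPairs_zero hw hrank
  rw [← cls_varietyX hw he] at h1
  rw [← cls_varietyY hli, h1] at h2
  simp only [Finset.sum_range_succ, Finset.sum_range_zero] at h2
  linear_combination h2

end Main

end

end PfaffianGrassmannian

theorem proposition2p8 :
    PfaffianGrassmannian.HoldsForGenericW fun W =>
      (PfaffianGrassmannian.K0Var.cls (PfaffianGrassmannian.varietyX W)
          - PfaffianGrassmannian.K0Var.cls (PfaffianGrassmannian.varietyY W))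
        * (PfaffianGrassmannian.K0Var.L ^ 2 - 1) * (PfaffianGrassmannian.K0Var.L - 1)
        * PfaffianGrassmannian.K0Var.L ^ 7 = 0 := by
  obtain ⟨F, hF, hdec⟩ := PfaffianGrassmannian.exists_polynomial_of_decomposable
  exact ⟨F, hF, fun w hw hli hFw =>
    PfaffianGrassmannian.cls_sub_mul_eq_zero hw hli
      (PfaffianGrassmannian.rank_pencil_ge hw (hdec w hFw))⟩
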